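/- Let $(W,S)$ be a Coxeter system with $S$ finite, let $|w|$ denote word length with respect to $S$, and let $\mathrm{Desc}(w)=\{s\in S : |sw|<|w|\}$. Let $\mathcal A$ be the set of nonempty spherical subsets of $S$ (those $\sigma$ generating a finite subgroup $W_\sigma$), and for $\sigma\in\mathcal A$ let $w_\sigma$ be the longest element of $W_\sigma$. The left greedy normal form $\mathcal L\subset\mathcal A^*$ is the language of all words $\sigma_n\cdots\sigma_1$ such that $\sigma_i=\mathrm{Desc}(w_{\sigma_i}w_{\sigma_{i-1}}\cdots w_{\sigma_1})$ for $i=1,\dots,n$, and $\chi=\sum_{\alpha\in\mathcal L}\alpha\in\mathbb Q\langle\langle\mathcal A\rangle\rangle$ is its characteristic series. Let $V=\mathbb R^S$ with coordinate functions $h_s$, let $v_s\in V$ be given by $h_{s'}(v_s)=-\cos(\pi/m(s,s'))$ (equal to $-1$ if $m(s,s')=\infty$), and let $W$ act on $V$ by the representation in which $s$ acts as $v\mapsto v-2h_s(v)v_s$. Let $C=\{v : h_s(v)\ge 0 \text{ for all } s\in S\}$ and let $U=\bigcup_{w\in W}wC$ be the Tits cone. Put $H_s=\{v\in U: h_s(v)=0\}$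 and $\mathcal H=\{wH_s : w\in W, s\in S\}$. For $H\in\mathcal H$ let $H^+$ and $H^-$ be the closed half-spaces of $U$ bounded by $H$ that, respectively, contain and do not contain $C$. Let $\mathcal H_{\min}$ be the set of minimal elements of $\mathcal H$ for the order $H_1\le H_2\iff H_1^+\subseteq H_2^+$, and let $\mathcal R$ be the set of (closed) regions into which the hyperplanes in $\mathcal H_{\min}$ cut $U$. For $\sigma\in\mathcal A$ let $A_\sigma^-=\{v\in U : v\in H_s^- \text{ for all } s\in\sigma\}$, and let $C_\sigma$ be the closure in $U$ of $A_\sigma^-\setminus\bigcup_{\tau\in\mathcal A,\ \sigma\subsetneq\tau}A_\tau^-$. Then $\mathcal R$ is finite. Let $Q$ be the $\mathcal R\times\mathcal R$ matrix over $\mathbb Q\langle\langle\mathcal A\rangle\rangle$ with $Q_{R',R}=\sigma$ if $w_\sigma R\subseteq R'$ and $R'\subseteq C_\sigma$ (which holds for at most one $\sigma\in\mathcal A$), and $Q_{R',R}=0$ if there is no such $\sigma$. Let $A$ be the row vector indexed by $\mathcal R$ with all entries $1$, and let $B$ be the column vector indexed by $\mathcal R$ with entry $1$ at the region $C$ and $0$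 elsewhere. Then $I-Q$ is invertible over $\mathbb Q\langle\langle\mathcal A\rangle\rangle$ and $$\chi=A(I-Q)^{-1}B.$$ In particular, $\chi$ is rational, i.e. it can be obtained from finitely many polynomials by finitely many additions, multiplications and quasi-inversions $\lambda\mapsto\lambda^+=\sum_{n\ge1}\lambda^n$ (the latter applied only to series with zero constant term). Equivalently, $\mathcal L$ is a regular language. -/

import Mathlib

namespace GreedyCoxeter

/-! ### Formal power series in noncommuting variables -/

section Series

/-- Formal power series over `ℚ` in noncommuting variables indexed by the alphabet `A`:
such a series assigns a rational coefficient to each word over `A`. -/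
def Series (A : Type*) : Type _ := List A → ℚ

namespace Series

/-- The coefficient of a word in a series. -/
def coeff {A : Type*} (f : Series A) (α : List A) : ℚ := f α

/-- The series with prescribed coefficients. -/
def mk {A : Type*} (c : List A → ℚ) : Series A := c

@[simp] theorem coeff_mk {A : Type*} (c : List A → ℚ) (α : List A) : (mk c).coeff α = c α := rfl

@[ext] theorem ext {A : Type*} {f g : Series A} (h : ∀ α, f.coeff α = g.coeff α) : f = g :=
  funext h

instance {A : Type*} : AddCommGroup (Series A) := inferInstanceAs (AddCommGroup (List A → ℚ))

@[simp] theorem coeff_add {A : Type*} (f g : Series A) (α : List A) :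
    (f + g).coeff α = f.coeff α + g.coeff α := rfl

@[simp] theorem coeff_zero {A : Type*} (α : List A) : (0 : Series A).coeff α = 0 := rfl

/-- The constant series `1`. -/
instance {A : Type*} : One (Series A) := ⟨mk fun α => if α.length = 0 then 1 else 0⟩

/-- The product: the coefficient of `α` is the sum of `⟨f, α₁⟩ ⟨g, α₂⟩` over all factorizations
`α = α₁ α₂`. -/
instance {A : Type*} : Mul (Series A) :=
  ⟨fun f g => mk fun α =>
    ∑ i ∈ Finset.range (α.length + 1), f.coeff (α.take i) * g.coeff (α.drop i)⟩

theorem coeff_one {A : Type*} (α : List A) :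
    (1 : Series A).coeff α = if α.length = 0 then 1 else 0 := rfl

theorem coeff_mul {A : Type*} (f g : Series A) (α : List A) :
    (f * g).coeff α =
      ∑ i ∈ Finset.range (α.length + 1), f.coeff (α.take i) * g.coeff (α.drop i) := rfl

theorem coeff_mul_nil {A : Type*} (f g : Series A) :
    (f * g).coeff [] = f.coeff [] * g.coeff [] := by simp [coeff_mul]

theorem coeff_mul_cons {A : Type*} (f g : Series A) (a : A) (α : List A) :
    (f * g).coeff (a :: α) =
      (mk (fun β => f.coeff (a :: β)) * g).coeff α + f.coeff [] * g.coeff (a :: α) := by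
  rw [coeff_mul, coeff_mul, List.length_cons, Finset.sum_range_succ']
  simp

private theorem mul_assoc_coeff {A : Type*} (g h : Series A) (α : List A) :
    ∀ f : Series A, (f * g * h).coeff α = (f * (g * h)).coeff α := by
  induction α with
  | nil => intro f; simp only [coeff_mul_nil]; ring
  | cons a α ih =>
    intro f
    have key : mk (fun β => (f * g).coeff (a :: β)) =
        mk (fun β => f.coeff (a :: β)) * g +
          mk (fun β => f.coeff [] * g.coeff (a :: β)) := by
      ext β
      rw [coeff_mk, coeff_mul_cons, coeff_add, coeff_mk]
    rw [coeff_mul_cons, key, coeff_mul_cons, coeff_mul_cons, ← ih]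
    have h1 : (( mk (fun β => f.coeff (a :: β)) * g +
          mk (fun β => f.coeff [] * g.coeff (a :: β))) * h).coeff α =
        (mk (fun β => f.coeff (a :: β)) * g * h).coeff α +
          f.coeff [] * (mk (fun β => g.coeff (a :: β)) * h).coeff α := by
      rw [coeff_mul _ h, coeff_mul _ h, coeff_mul _ h, Finset.mul_sum, ← Finset.sum_add_distrib]
      refine Finset.sum_congr rfl fun i _ => ?_
      rw [coeff_add, coeff_mk, coeff_mk]; ring
    rw [h1, coeff_mul_nil]; ring

instance {A : Type*} : Ring (Series A) :=
  { (inferInstance : AddCommGroup (Series A)) with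
    one := 1
    mul := (· * ·)
    left_distrib := fun f g h => by
      ext α
      rw [coeff_add, coeff_mul, coeff_mul, coeff_mul, ← Finset.sum_add_distrib]
      exact Finset.sum_congr rfl fun i _ => mul_add _ _ _
    right_distrib := fun f g h => by
      ext α
      rw [coeff_add, coeff_mul, coeff_mul, coeff_mul, ← Finset.sum_add_distrib]
      exact Finset.sum_congr rfl fun i _ => add_mul _ _ _
    zero_mul := fun f => by
      ext α
      rw [coeff_mul]
      simp
    mul_zero := fun f => by
      ext α
      rw [coeff_mul]
      simp
    mul_assoc := fun f g h => by
      ext α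
      exact mul_assoc_coeff g h α f
    one_mul := fun f => by
      ext α
      have := Finset.sum_eq_single (s := Finset.range (α.length + 1)) (a := 0)
        (f := fun i => (1 : Series A).coeff (α.take i) * f.coeff (α.drop i))
        (fun i hi h0 => by
          have : (α.take i).length ≠ 0 := by
            have := Finset.mem_range.1 hi
            rw [List.length_take]; omega
          simp only [coeff_one, if_neg this, zero_mul]) (by simp)
      refine this.trans ?_
      simp [coeff_one]
    mul_one := fun f => by
      ext α
      have := Finset.sum_eq_single (s := Finset.range (α.length + 1)) (a := α.length)
        (f := fun i => f.coeff (α.take i) * (1 : Series A).coeff (α.drop i))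
        (fun i hi h0 => by
          have : (α.drop i).length ≠ 0 := by
            have := Finset.mem_range.1 hi
            rw [List.length_drop]; omega
          simp only [coeff_one, if_neg this, mul_zero]) (by simp)
      refine this.trans ?_
      simp [coeff_one] }

/-- A polynomial is a series with finite support. -/
def IsPolynomial {A : Type*} (f : Series A) : Prop := {α | f.coeff α ≠ 0}.Finite

/-- `g` is the quasi-inverse `f⁺ = ∑_{n ≥ 1} fⁿ` of the quasi-regular (zero constant term)
series `f`; the infinite sum is the coefficientwise (eventually constant) limit of its
partial sums. -/
def IsQuasiInverse {A : Type*} (f g : Series A) : Prop :=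
  f.coeff [] = 0 ∧
    ∀ α, ∀ᶠ N : ℕ in Filter.atTop, (∑ n ∈ Finset.Icc 1 N, f ^ n).coeff α = g.coeff α

/-- Rational series: those obtained from polynomials by finitely many additions,
multiplications and quasi-inversions. -/
inductive IsRational {A : Type*} : Series A → Prop
  | polynomial {f : Series A} (hf : f.IsPolynomial) : IsRational f
  | add {f g : Series A} (hf : IsRational f) (hg : IsRational g) : IsRational (f + g)
  | mul {f g : Series A} (hf : IsRational f) (hg : IsRational g) : IsRational (f * g)
  | quasiInverse {f g : Series A} (hf : IsRational f) (h : IsQuasiInverse f g) : IsRational g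

open Classical in
/-- The characteristic series of a language: the sum of its words. -/
noncomputable def charSeries {A : Type*} (L : Language A) : Series A :=
  mk fun α => if α ∈ L then 1 else 0

end Series

end Series

/-! ### The left greedy normal form -/

section Greedy

variable {B W : Type*} [Group W] {M : CoxeterMatrix B} (cs : CoxeterSystem M W)

/-- The parabolic subgroup `W_σ` generated by a set `σ` of simple reflections. -/
def parabolic (σ : Set B) : Subgroup W := Subgroup.closure (cs.simple '' σ)

/-- `σ` is spherical if it generates a finite subgroup. -/
def IsSpherical (σ : Set B) : Prop := (parabolic cs σ : Set W).Finite

/-- The alphabet (proper nerve): the nonempty spherical subsets of the generating set. -/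
def Letter : Type _ := {σ : Set B // σ.Nonempty ∧ IsSpherical cs σ}

theorem exists_longest (σ : Letter cs) :
    ∃ w ∈ (parabolic cs σ.1 : Set W), ∀ v ∈ (parabolic cs σ.1 : Set W),
      cs.length v ≤ cs.length w :=
  Set.exists_max_image _ _ σ.2.2 ⟨1, (parabolic cs σ.1).one_mem⟩

/-- `w_σ`, the (unique) element of longest length in `W_σ`. -/
noncomputable def longest (σ : Letter cs) : W := (exists_longest cs σ).choose

/-- The left descent set `Desc(w) = {s | |sw| < |w|}`. -/
def desc (w : W) : Set B := {s | cs.IsLeftDescent w s}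

/-- The product `π(σₙ ⋯ σ₁) = w_{σₙ} ⋯ w_{σ₁}`; the word `σₙ ⋯ σ₁` is the list
`[σₙ, …, σ₁]`. -/
noncomputable def wordElt (α : List (Letter cs)) : W := (α.map (longest cs)).prod

/-- The left greedy normal form: the words `σₙ ⋯ σ₁` such that each `σᵢ` is the left descent
set of `w_{σᵢ} ⋯ w_{σ₁}`. -/
def greedy : Language (Letter cs) :=
  {α | ∀ (σ : Letter cs) (β : List (Letter cs)), (σ :: β) <:+ α →
    σ.1 = desc cs (wordElt cs (σ :: β))}

end Greedy

/-! ### The geometric representation -/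

section Geometry

variable {B : Type*} (M : CoxeterMatrix B)

/-- The vector `v_s` of `V = (B → ℝ)`, determined by `h_{s'}(v_s) = -cos(π / m(s, s'))`, where the
`h_{s'}` are the coordinate functions. Infinite `m(s, s')` is encoded as `0`; the value is then
`-1` as it should be. -/
noncomputable def rootVec (s : B) : B → ℝ := fun s' => -Real.cos (Real.pi / (M s s' : ℝ))

theorem two_proj_rootVec (s : B) :
    ((2 : ℝ) • (LinearMap.proj s : (B → ℝ) →ₗ[ℝ] ℝ)) (rootVec M s) = 2 := by
  simp [rootVec]

/-- The reflection `ρ_s(v) = v - 2 h_s(v) v_s`. -/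
noncomputable def simpleRefl (s : B) : (B → ℝ) ≃ₗ[ℝ] (B → ℝ) :=
  Module.reflection (two_proj_rootVec M s)

theorem simpleRefl_apply (s : B) (v : B → ℝ) :
    simpleRefl M s v = v - (2 * v s) • rootVec M s := by
  simp [simpleRefl, Module.reflection_apply]

/-- The reflections `ρ_s` satisfy the Coxeter relations. -/
theorem simpleRefl_isLiftable : M.IsLiftable (simpleRefl M) := by
  intro i j
  have hsq : ∀ s, simpleRefl M s * simpleRefl M s = 1 := fun s =>
    LinearEquiv.ext fun v => Module.involutive_reflection (two_proj_rootVec M s) v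
  by_cases hij : i = j
  · subst hij; rw [hsq, one_pow]
  have h1 : M i j ≠ 1 := M.off_diagonal i j hij
  rcases Nat.eq_zero_or_pos (M i j) with h0 | hpos
  · rw [h0, pow_zero]
  by_cases h2 : M i j = 2
  · have hcos : ∀ {s t : B}, M s t = 2 → rootVec M s t = 0 := fun h => by simp [rootVec, h]
    have e1 := hcos h2
    have e2 := hcos ((M.symmetric j i).trans h2)
    have hcomm : simpleRefl M i * simpleRefl M j = simpleRefl M j * simpleRefl M i := by
      refine LinearEquiv.ext fun v => ?_
      simp only [LinearEquiv.mul_apply, simpleRefl_apply, Pi.sub_apply, Pi.smul_apply, e1, e2,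
        smul_eq_mul, mul_zero, sub_zero]
      abel
    have h4 : (simpleRefl M i * simpleRefl M j) ^ 2 = 1 := by
      rw [pow_two]
      nth_rewrite 1 [hcomm]
      rw [mul_assoc, ← mul_assoc (simpleRefl M i), hsq, one_mul, hsq]
    rw [h2, h4]
  have h3 : 3 ≤ M i j := by omega
  have hm : (0 : ℝ) < (M i j : ℝ) := by exact_mod_cast hpos
  set θ : ℝ := 2 * (Real.pi / (M i j : ℝ)) with hθ
  have hmθ : (M i j : ℝ) * θ = 2 * Real.pi := by rw [hθ]; field_simp
  have hsin : Real.sin θ ≠ 0 := by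
    refine (Real.sin_pos_of_pos_of_lt_pi (by positivity) ?_).ne'
    have h3' : (3 : ℝ) ≤ (M i j : ℝ) := by exact_mod_cast h3
    nlinarith [Real.pi_pos]
  have hS : ∀ n : ℤ, (Polynomial.Chebyshev.S ℝ n).eval (2 * Real.cos θ) =
      Real.sin ((n + 1) * θ) / Real.sin θ := fun n => by
    rw [eq_div_iff hsin, Polynomial.Chebyshev.S_two_mul_real_cos]
  have ht : 2 * Real.cos θ = ((2 : ℝ) • (LinearMap.proj i : (B → ℝ) →ₗ[ℝ] ℝ)) (rootVec M j) *
      ((2 : ℝ) • (LinearMap.proj j : (B → ℝ) →ₗ[ℝ] ℝ)) (rootVec M i) - 2 := by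
    simp only [LinearMap.smul_apply, LinearMap.proj_apply, smul_eq_mul, rootVec]
    rw [M.symmetric j i, hθ, Real.cos_two_mul]
    ring
  refine LinearEquiv.ext fun z => ?_
  have key := Module.reflection_mul_reflection_pow_apply (two_proj_rootVec M i)
    (two_proj_rootVec M j) (M i j) z _ ht
  refine key.trans ?_
  rcases Nat.even_or_odd' (M i j) with ⟨k, hk | hk⟩
  · have d1 : ((M i j : ℤ) - 2) / 2 = k - 1 := by omega
    have d2 : ((M i j : ℤ) - 1) / 2 = k - 1 := by omega
    have z1 : (Polynomial.Chebyshev.S ℝ ((k : ℤ) - 1)).eval (2 * Real.cos θ) = 0 := by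
      have : (((k : ℤ) - 1 : ℤ) + 1 : ℝ) * θ = Real.pi := by
        push_cast
        rw [hk] at hmθ
        push_cast at hmθ
        linarith
      rw [hS, this, Real.sin_pi, zero_div]
    rw [d1, d2, z1]
    simp
  · have d1 : ((M i j : ℤ) - 2) / 2 = k - 1 := by omega
    have d2 : ((M i j : ℤ) - 1) / 2 = k := by omega
    have d3 : ((M i j : ℤ) - 3) / 2 = k - 1 := by omega
    have d4 : (M i j : ℤ) / 2 = k := by omega
    have z1 : (Polynomial.Chebyshev.S ℝ (k : ℤ)).eval (2 * Real.cos θ) +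
        (Polynomial.Chebyshev.S ℝ ((k : ℤ) - 1)).eval (2 * Real.cos θ) = 0 := by
      have : (((k : ℤ) : ℝ) + 1) * θ = 2 * Real.pi - (((k : ℤ) - 1 : ℤ) + 1 : ℝ) * θ := by
        push_cast
        rw [hk] at hmθ
        push_cast at hmθ
        linarith
      rw [hS, hS, this, Real.sin_two_pi_sub]
      ring
    rw [d1, d2, d3, d4, z1]
    simp

variable {M} {W : Type*} [Group W] (cs : CoxeterSystem M W)

/-- The geometric representation of `W` on `V = (B → ℝ)`. -/
noncomputable def geomRep : W →* ((B → ℝ) ≃ₗ[ℝ] (B → ℝ)) :=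
  cs.lift ⟨simpleRefl M, simpleRefl_isLiftable M⟩

/-- The fundamental chamber `C`. -/
def fundChamber (B : Type*) : Set (B → ℝ) := {v | ∀ s, 0 ≤ v s}

/-- The Tits cone `U`, the union of the chambers `wC`. -/
def titsCone : Set (B → ℝ) := ⋃ w : W, geomRep cs w '' fundChamber B

/-- The fundamental hyperplane `H_s` in `U`. -/
def fundHyperplane (s : B) : Set (B → ℝ) := {v ∈ titsCone cs | v s = 0}

/-- The set of hyperplanes `wH_s` in `U`. -/
def hyperplanes : Set (Set (B → ℝ)) := {H | ∃ (w : W) (s : B), H = geomRep cs w '' fundHyperplane cs s}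

/-- `K` is one of the two (closed) half-spaces of `U` bounded by the hyperplane `H` of `U`. -/
def IsHalfspace (H K : Set (B → ℝ)) : Prop :=
  ∃ f : (B → ℝ) →ₗ[ℝ] ℝ, H = {v ∈ titsCone cs | f v = 0} ∧ K = {v ∈ titsCone cs | 0 ≤ f v}

/-- `H⁺`: the half-space bounded by `H` that contains the fundamental chamber. -/
def posHalf (H : Set (B → ℝ)) : Set (B → ℝ) :=
  {v | ∃ K, IsHalfspace cs H K ∧ fundChamber B ⊆ K ∧ v ∈ K}

/-- `H⁻`: the half-space bounded by `H` that does not contain the fundamental chamber. -/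
def negHalf (H : Set (B → ℝ)) : Set (B → ℝ) :=
  {v | ∃ K, IsHalfspace cs H K ∧ ¬ fundChamber B ⊆ K ∧ v ∈ K}

/-- The minimal hyperplanes: the minimal elements for the order `H₁ ≤ H₂ ↔ H₁⁺ ⊆ H₂⁺`. -/
def minHyperplanes : Set (Set (B → ℝ)) :=
  {H | MinimalFor (· ∈ hyperplanes cs) (posHalf cs) H}

/-- The (closed) regions of `U` cut out by the minimal hyperplanes: a point `v` of `U` on none of
these hyperplanes determines the region of all points of `U` that lie in the same half-spaces
bounded by minimal hyperplanes as `v`. -/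
def regions : Set (Set (B → ℝ)) :=
  {R | ∃ v ∈ titsCone cs, (∀ H ∈ minHyperplanes cs, v ∉ H) ∧
    R = {x ∈ titsCone cs | ∀ H ∈ minHyperplanes cs, ∀ K, IsHalfspace cs H K → v ∈ K → x ∈ K}}

/-- The index type of the matrix `Q`. -/
def Region : Type _ := {R : Set (B → ℝ) // R ∈ regions cs}

noncomputable instance : DecidableEq (Region cs) := Classical.decEq _

/-- `A_σ⁻`, the intersection of the half-spaces `H_s⁻` in `U` for `s ∈ σ`. -/
def antiCone (σ : Set B) : Set (B → ℝ) :=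
  {v ∈ titsCone cs | ∀ s ∈ σ, v ∈ negHalf cs (fundHyperplane cs s)}

/-- `C_σ`, the closure in `U` of `A_σ⁻` minus the union of the `A_τ⁻` for spherical `τ`
properly containing `σ`. -/
def descCone (σ : Letter cs) : Set (B → ℝ) :=
  titsCone cs ∩ closure (antiCone cs σ.1 \ ⋃ τ : {τ : Letter cs // σ.1 ⊂ τ.1}, antiCone cs τ.1.1)

open Classical in
/-- The matrix `Q`: its `(R', R)` entry is the letter `σ` if `w_σ R ⊆ R'` and `R' ⊆ C_σ` (this
holds for at most one `σ`), and `0` if there is no such `σ`. -/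
noncomputable def transitionMatrix : Matrix (Region cs) (Region cs) (Series (Letter cs)) :=
  fun R' R => Series.mk fun α =>
    if ∃ σ : Letter cs, α = [σ] ∧ geomRep cs (longest cs σ) '' R.1 ⊆ R'.1 ∧ R'.1 ⊆ descCone cs σ
    then 1 else 0

/-- The row vector `A = (1, …, 1)`. -/
def rowVec : Region cs → Series (Letter cs) := fun _ => 1

open Classical in
/-- The column vector `B`, with entry `1` at the fundamental chamber and `0` elsewhere. -/
noncomputable def colVec : Region cs → Series (Letter cs) :=
  fun R => if R.1 = fundChamber B then 1 else 0

end Geometry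

end GreedyCoxeter

/-!
The argument is organised around roots, taken as linear functionals on `V`: the orbit of the
coordinate functions `h_s` under the contragredient action of `W`. An invariant form `B` with
`B(h_s, h_t) = -cos (π / m(s, t))` lives on functionals. Every root is a nonnegative or a nonpositive
combination of the `h_s`, and `w h_s` is negative exactly when `s` is a right descent of `w`
(`dualAct_simpleRoot_nonneg`, `isPosRoot_dualAct_iff`). It follows that each `w` inverts finitely
many positive roots, that it is determined by them, and that the Tits cone is the convex cone of
points at which only finitely many positive roots are negative (`mem_titsCone_iff`).

The regions are finite in number because the minimal hyperplanes are. These correspond to the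
minimal roots, and their finiteness is the theorem of Brink and Howlett (`finite_isMinRoot`). Two
facts about pairs of roots carry it. If `B(α, β) ≥ 1`, then the half-spaces of `α` and `β` are nested
(`halfOf_subset_or_subset`), so two distinct minimal roots have inner product less than `1`. If
`|B(α, β)| < 1`, then both roots can be moved into a parabolic subsystem with finitely many roots, so
`B(α, β)` lies in a fixed finite set (`finite_rootForm_values`). A minimal root can be lowered to a
simple root through minimal roots, and along the way the vector of the numbers
`max (-1) (B(φ, h_s))` takes finitely many values and never repeats (`truncatedGram_ne_of_chain`);
this bounds the number of steps.

The regions are the states of an automaton. A region lies in `C_σ` if and only if the chambers `uC`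
in it satisfy `Desc(u) = σ` (`regionOf_subset_descCone_iff`). If `Desc(w_σ u) = σ`, then the region
of `uC` lies on the positive side of `H_s` for `s ∈ σ`, and minimality of the hyperplanes implies
that none of them cuts its translate by `w_σ` (`image_regionOf_subset`). Hence the entry `σ` of `Q`
in the column of the region of `uC` occurs exactly when `Desc(w_σ u) = σ`, in the row of the region
of `w_σ uC` (`transition_iff`), which is the condition for a greedy word to be extended by `σ`.

Let `X_R` be the sum of the greedy words whose product lies in `R`. Splitting off the first letter
gives `X = b + Q X`, with `b` the column vector `colVec` (`regionSeries_eq`), and `1 - Q` is invertible as `Q` has no constant terms. So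
`χ = ∑ X_R = A (1 - Q)⁻¹ b`. Eliminating one variable at a time from the linear system shows that
the `X_R` are rational, and following the nonzero entries of `Q` recognizes the reversed language.
-/

set_option linter.unusedSectionVars false

namespace GreedyCoxeter

open Module

/-! ### Roots as linear functionals -/

section Roots

variable {B W : Type*} [Fintype B] [DecidableEq B] [Group W] {M : CoxeterMatrix B}
  (cs : CoxeterSystem M W)

theorem geomRep_simple (s : B) (v : B → ℝ) :
    geomRep cs (cs.simple s) v = v - (2 * v s) • rootVec M s := by
  rw [geomRep, cs.lift_apply_simple, simpleRefl_apply]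

@[simp] theorem geomRep_one_apply (v : B → ℝ) : geomRep cs 1 v = v := by simp

theorem geomRep_mul_apply (w w' : W) (v : B → ℝ) :
    geomRep cs (w * w') v = geomRep cs w (geomRep cs w' v) := by simp

@[simp] theorem geomRep_inv_apply_self (w : W) (v : B → ℝ) :
    geomRep cs w⁻¹ (geomRep cs w v) = v := by
  rw [← geomRep_mul_apply, inv_mul_cancel, geomRep_one_apply]

@[simp] theorem geomRep_apply_inv_self (w : W) (v : B → ℝ) :
    geomRep cs w (geomRep cs w⁻¹ v) = v := by
  rw [← geomRep_mul_apply, mul_inv_cancel, geomRep_one_apply]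

/-- The contragredient action of `W` on linear functionals: `(w φ)(v) = φ (w⁻¹ v)`. -/
noncomputable def dualAct (w : W) : Dual ℝ (B → ℝ) →ₗ[ℝ] Dual ℝ (B → ℝ) :=
  (geomRep cs w⁻¹).toLinearMap.dualMap

theorem dualAct_apply (w : W) (φ : Dual ℝ (B → ℝ)) (v : B → ℝ) :
    dualAct cs w φ v = φ (geomRep cs w⁻¹ v) := rfl

@[simp] theorem dualAct_geomRep (w : W) (φ : Dual ℝ (B → ℝ)) (v : B → ℝ) :
    dualAct cs w φ (geomRep cs w v) = φ v := by
  rw [dualAct_apply, geomRep_inv_apply_self]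

@[simp] theorem dualAct_one (φ : Dual ℝ (B → ℝ)) : dualAct cs 1 φ = φ := by
  apply LinearMap.ext; intro v
  rw [dualAct_apply, inv_one, geomRep_one_apply]

theorem dualAct_mul (w w' : W) (φ : Dual ℝ (B → ℝ)) :
    dualAct cs (w * w') φ = dualAct cs w (dualAct cs w' φ) := by
  apply LinearMap.ext; intro v
  rw [dualAct_apply, dualAct_apply, dualAct_apply, mul_inv_rev, geomRep_mul_apply]

@[simp] theorem dualAct_inv_self (w : W) (φ : Dual ℝ (B → ℝ)) :
    dualAct cs w⁻¹ (dualAct cs w φ) = φ := by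
  rw [← dualAct_mul, inv_mul_cancel, dualAct_one]

@[simp] theorem dualAct_self_inv (w : W) (φ : Dual ℝ (B → ℝ)) :
    dualAct cs w (dualAct cs w⁻¹ φ) = φ := by
  rw [← dualAct_mul, mul_inv_cancel, dualAct_one]

/-- The simple root `h_s`, a coordinate function. -/
def simpleRoot (s : B) : Dual ℝ (B → ℝ) := LinearMap.proj s

@[simp] theorem simpleRoot_apply (s : B) (v : B → ℝ) : simpleRoot s v = v s := rfl

/-- The coefficient of a functional at the simple root `h_t`. -/
def rootCoeff (φ : Dual ℝ (B → ℝ)) (t : B) : ℝ := φ (Pi.single t 1)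

@[simp] theorem rootCoeff_add (φ ψ : Dual ℝ (B → ℝ)) (t : B) :
    rootCoeff (φ + ψ) t = rootCoeff φ t + rootCoeff ψ t := rfl

@[simp] theorem rootCoeff_sub (φ ψ : Dual ℝ (B → ℝ)) (t : B) :
    rootCoeff (φ - ψ) t = rootCoeff φ t - rootCoeff ψ t := rfl

@[simp] theorem rootCoeff_neg (φ : Dual ℝ (B → ℝ)) (t : B) :
    rootCoeff (-φ) t = -rootCoeff φ t := rfl

@[simp] theorem rootCoeff_smul (c : ℝ) (φ : Dual ℝ (B → ℝ)) (t : B) :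
    rootCoeff (c • φ) t = c * rootCoeff φ t := rfl

theorem rootCoeff_simpleRoot (s t : B) :
    rootCoeff (simpleRoot s) t = if s = t then 1 else 0 := by
  simp [rootCoeff, Pi.single_apply]

theorem apply_eq_sum_rootCoeff (φ : Dual ℝ (B → ℝ)) (v : B → ℝ) :
    φ v = ∑ t, rootCoeff φ t * v t := by
  conv_lhs => rw [pi_eq_sum_univ' v]
  simp [map_sum, rootCoeff, mul_comm]

theorem dual_ext_rootCoeff {φ ψ : Dual ℝ (B → ℝ)} (h : ∀ t, rootCoeff φ t = rootCoeff ψ t) :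
    φ = ψ := by
  apply LinearMap.ext; intro v
  simp only [apply_eq_sum_rootCoeff, h]

theorem rootVec_symm (M : CoxeterMatrix B) (s t : B) : rootVec M s t = rootVec M t s := by
  simp only [rootVec, M.symmetric s t]

@[simp] theorem rootVec_self (M : CoxeterMatrix B) (s : B) : rootVec M s s = 1 := by
  simp [rootVec]

theorem rootVec_nonpos (M : CoxeterMatrix B) {s t : B} (h : s ≠ t) : rootVec M s t ≤ 0 := by
  have h1 : M s t ≠ 1 := M.off_diagonal s t h
  rw [rootVec, neg_nonpos]
  rcases Nat.eq_zero_or_pos (M s t) with h0 | hpos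
  · simp [h0]
  have h2 : (2 : ℝ) ≤ M s t := by exact_mod_cast (by omega : 2 ≤ M s t)
  apply Real.cos_nonneg_of_mem_Icc
  refine ⟨?_, ?_⟩
  · have : 0 ≤ Real.pi / (M s t : ℝ) := by positivity
    linarith [Real.pi_pos]
  · exact div_le_div_of_nonneg_left Real.pi_pos.le (by norm_num) h2

theorem dualAct_simple (s : B) (φ : Dual ℝ (B → ℝ)) :
    dualAct cs (cs.simple s) φ = φ - (2 * φ (rootVec M s)) • simpleRoot s := by
  apply LinearMap.ext; intro v
  simp [dualAct_apply, geomRep_simple]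
  ring

theorem dualAct_simple_simpleRoot (s : B) :
    dualAct cs (cs.simple s) (simpleRoot s) = -simpleRoot s := by
  rw [dualAct_simple, simpleRoot_apply, rootVec_self, mul_one, two_smul]; abel

/-- The vector `∑ φ(e_t) v_t` of `V` that corresponds to a functional `φ = ∑ φ(e_t) h_t`; it sends
the simple root `h_s` to `v_s`. -/
noncomputable def polar (M : CoxeterMatrix B) : Dual ℝ (B → ℝ) →ₗ[ℝ] (B → ℝ) where
  toFun φ := ∑ t, rootCoeff φ t • rootVec M t
  map_add' φ ψ := by simp [add_smul, Finset.sum_add_distrib]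
  map_smul' c φ := by simp [mul_smul, Finset.smul_sum]

theorem polar_apply (φ : Dual ℝ (B → ℝ)) : polar M φ = ∑ t, rootCoeff φ t • rootVec M t := rfl

@[simp] theorem polar_simpleRoot (s : B) : polar M (simpleRoot s) = rootVec M s := by
  simp [polar_apply, rootCoeff_simpleRoot]

/-- The invariant bilinear form on functionals, with `B(h_s, h_t) = -cos (π / m(s, t))`. -/
noncomputable def rootForm (M : CoxeterMatrix B) (φ ψ : Dual ℝ (B → ℝ)) : ℝ := ψ (polar M φ)

theorem rootForm_eq_sum (φ ψ : Dual ℝ (B → ℝ)) :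
    rootForm M φ ψ = ∑ t, rootCoeff φ t * ψ (rootVec M t) := by
  simp [rootForm, polar_apply]

theorem rootForm_symm (φ ψ : Dual ℝ (B → ℝ)) : rootForm M φ ψ = rootForm M ψ φ := by
  have h : ∀ φ ψ, rootForm M φ ψ =
      ∑ t, ∑ u, rootCoeff φ t * (rootCoeff ψ u * rootVec M t u) := fun φ ψ => by
    rw [rootForm_eq_sum]
    refine Finset.sum_congr rfl fun t _ => ?_
    rw [apply_eq_sum_rootCoeff ψ, Finset.mul_sum]
  rw [h, h, Finset.sum_comm]
  refine Finset.sum_congr rfl fun t _ => Finset.sum_congr rfl fun u _ => ?_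
  rw [rootVec_symm M u t]; ring

@[simp] theorem rootForm_sub_left (φ φ' ψ : Dual ℝ (B → ℝ)) :
    rootForm M (φ - φ') ψ = rootForm M φ ψ - rootForm M φ' ψ := by simp [rootForm]

@[simp] theorem rootForm_smul_left (c : ℝ) (φ ψ : Dual ℝ (B → ℝ)) :
    rootForm M (c • φ) ψ = c * rootForm M φ ψ := by simp [rootForm]

@[simp] theorem rootForm_sub_right (φ ψ ψ' : Dual ℝ (B → ℝ)) :
    rootForm M φ (ψ - ψ') = rootForm M φ ψ - rootForm M φ ψ' := rfl

@[simp] theorem rootForm_smul_right (c : ℝ) (φ ψ : Dual ℝ (B → ℝ)) :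
    rootForm M φ (c • ψ) = c * rootForm M φ ψ := rfl

theorem apply_rootVec (φ : Dual ℝ (B → ℝ)) (s : B) :
    φ (rootVec M s) = rootForm M φ (simpleRoot s) := by
  rw [rootForm_symm, rootForm, polar_simpleRoot]

theorem rootForm_simpleRoot (s t : B) :
    rootForm M (simpleRoot s) (simpleRoot t) = rootVec M s t := by
  rw [rootForm, polar_simpleRoot, simpleRoot_apply]

/-- The form in terms of the simple coefficients of its first argument. -/
theorem rootForm_eq_sum_coeff (φ ψ : Dual ℝ (B → ℝ)) :
    rootForm M φ ψ = ∑ t, rootCoeff φ t * rootForm M ψ (simpleRoot t) := by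
  simp only [rootForm_eq_sum φ, apply_rootVec]

theorem dualAct_simple' (s : B) (φ : Dual ℝ (B → ℝ)) :
    dualAct cs (cs.simple s) φ = φ - (2 * rootForm M φ (simpleRoot s)) • simpleRoot s := by
  rw [dualAct_simple, apply_rootVec]

theorem polar_dualAct (w : W) (φ : Dual ℝ (B → ℝ)) :
    polar M (dualAct cs w φ) = geomRep cs w (polar M φ) := by
  induction w using cs.simple_induction_left generalizing φ with
  | one => simp
  | mul_simple_left w s ih =>
    rw [dualAct_mul, geomRep_mul_apply, ← ih, dualAct_simple, geomRep_simple, map_sub, map_smul,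
      polar_simpleRoot]
    congr 3
    rw [apply_rootVec, rootForm, simpleRoot_apply]

@[simp] theorem rootForm_dualAct (w : W) (φ ψ : Dual ℝ (B → ℝ)) :
    rootForm M (dualAct cs w φ) (dualAct cs w ψ) = rootForm M φ ψ := by
  rw [rootForm, polar_dualAct, dualAct_geomRep, rootForm]

/-- A root: a functional in the orbit of some simple root. -/
def IsRoot (φ : Dual ℝ (B → ℝ)) : Prop := ∃ (w : W) (s : B), φ = dualAct cs w (simpleRoot s)

/-- A positive root: one with nonnegative simple coefficients. -/
def IsPosRoot (φ : Dual ℝ (B → ℝ)) : Prop := IsRoot cs φ ∧ ∀ t, 0 ≤ rootCoeff φ t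

variable {cs}

theorem isRoot_simpleRoot (s : B) : IsRoot cs (simpleRoot s) := ⟨1, s, by simp⟩

theorem isPosRoot_simpleRoot (s : B) : IsPosRoot cs (simpleRoot s) :=
  ⟨isRoot_simpleRoot s, fun t => by rw [rootCoeff_simpleRoot]; split_ifs <;> norm_num⟩

theorem IsRoot.dualAct {φ : Dual ℝ (B → ℝ)} (h : IsRoot cs φ) (w : W) :
    IsRoot cs (dualAct cs w φ) := by
  obtain ⟨w', s, rfl⟩ := h
  exact ⟨w * w', s, (dualAct_mul ..).symm⟩

theorem IsRoot.neg {φ : Dual ℝ (B → ℝ)} (h : IsRoot cs φ) : IsRoot cs (-φ) := by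
  obtain ⟨w, s, rfl⟩ := h
  exact ⟨w * cs.simple s, s, by rw [dualAct_mul, dualAct_simple_simpleRoot, map_neg]⟩

theorem IsRoot.rootForm_self {φ : Dual ℝ (B → ℝ)} (h : IsRoot cs φ) : rootForm M φ φ = 1 := by
  obtain ⟨w, s, rfl⟩ := h
  rw [rootForm_dualAct, rootForm_simpleRoot, rootVec_self]

theorem IsRoot.ne_zero {φ : Dual ℝ (B → ℝ)} (h : IsRoot cs φ) : φ ≠ 0 := by
  rintro rfl
  have := h.rootForm_self
  simp [rootForm] at this

/-- The reflection in a root is an element of `W`. -/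
theorem IsRoot.exists_reflection {φ : Dual ℝ (B → ℝ)} (h : IsRoot cs φ) :
    ∃ r : W, (∀ ψ, GreedyCoxeter.dualAct cs r ψ = ψ - (2 * rootForm M ψ φ) • φ) := by
  obtain ⟨w, s, rfl⟩ := h
  refine ⟨w * cs.simple s * w⁻¹, fun ψ => ?_⟩
  rw [dualAct_mul, dualAct_mul, dualAct_simple', map_sub, map_smul, dualAct_self_inv,
    ← rootForm_dualAct cs w, dualAct_self_inv]

end Roots

/-! ### Positivity of roots -/

section Positivity

open CoxeterSystem

variable {B W : Type*} [Fintype B] [DecidableEq B] [Group W] {M : CoxeterMatrix B}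
  (cs : CoxeterSystem M W)

/-- The roots of a dihedral parabolic subgroup, in Chebyshev coordinates. -/
theorem dualAct_alternatingWord (s t : B) (k : ℕ) :
    dualAct cs (cs.wordProd (alternatingWord s t k)) (simpleRoot s) =
      (Polynomial.Chebyshev.U ℝ k).eval (-rootVec M s t) •
          simpleRoot (if Even k then s else t) +
        (Polynomial.Chebyshev.U ℝ (k - 1 : ℤ)).eval (-rootVec M s t) •
          simpleRoot (if Even k then t else s) := by
  induction k with
  | zero => simp [alternatingWord]
  | succ k ih =>
    have hU : (Polynomial.Chebyshev.U ℝ ((k + 1 : ℕ) : ℤ)).eval (-rootVec M s t) =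
        2 * (-rootVec M s t) * (Polynomial.Chebyshev.U ℝ k).eval (-rootVec M s t) -
          (Polynomial.Chebyshev.U ℝ (k - 1 : ℤ)).eval (-rootVec M s t) := by
      have := Polynomial.Chebyshev.U_add_two ℝ ((k : ℤ) - 1)
      rw [show (k : ℤ) - 1 + 2 = ((k + 1 : ℕ) : ℤ) by push_cast; ring,
        show (k : ℤ) - 1 + 1 = k by ring] at this
      rw [this]; simp
    rw [alternatingWord_succ', cs.wordProd_cons, dualAct_mul, ih, hU]
    push_cast
    rw [add_sub_cancel_right]
    have hs := rootVec_symm M s t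
    by_cases hk : Even k
    · have hk' : ¬ Even (k + 1) := by simpa [Nat.even_add_one] using hk
      simp only [hk, hk', if_true, if_false, map_add, map_smul, dualAct_simple_simpleRoot]
      rw [dualAct_simple', rootForm_simpleRoot]
      module
    · have hk' : Even (k + 1) := by simpa [Nat.even_add_one] using hk
      simp only [hk, hk', if_true, if_false, map_add, map_smul, dualAct_simple_simpleRoot]
      rw [dualAct_simple', rootForm_simpleRoot, ← hs]
      module

theorem chebyshev_U_nonneg {s t : B} (hst : s ≠ t) {k : ℕ} (hk : M s t = 0 ∨ k ≤ M s t) :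
    0 ≤ (Polynomial.Chebyshev.U ℝ (k - 1 : ℤ)).eval (-rootVec M s t) := by
  rw [rootVec, neg_neg]
  rcases Nat.eq_zero_or_pos (M s t) with h0 | hpos
  · simp [h0, Polynomial.Chebyshev.U_eval_one]
  · have hk : k ≤ M s t := by omega
    have h1 : M s t ≠ 1 := M.off_diagonal s t hst
    have hm : (2 : ℝ) ≤ M s t := by exact_mod_cast (by omega : 2 ≤ M s t)
    have hsin : 0 < Real.sin (Real.pi / M s t) := by
      apply Real.sin_pos_of_pos_of_lt_pi (by positivity)
      rw [div_lt_iff₀ (by linarith)]; nlinarith [Real.pi_pos]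
    have := Polynomial.Chebyshev.U_real_cos (Real.pi / M s t) (k - 1 : ℤ)
    have h2 : 0 ≤ Real.sin ((((k : ℤ) - 1 : ℤ) + 1 : ℝ) * (Real.pi / M s t)) := by
      apply Real.sin_nonneg_of_nonneg_of_le_pi
      · push_cast; rw [sub_add_cancel]; positivity
      · push_cast; rw [sub_add_cancel]
        have hk' : (k : ℝ) ≤ M s t := by exact_mod_cast hk
        calc (k : ℝ) * (Real.pi / M s t) ≤ M s t * (Real.pi / M s t) := by
              gcongr
          _ = Real.pi := by field_simp
    rw [← this] at h2
    exact nonneg_of_mul_nonneg_left h2 hsin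

/-- If `s` is not a right descent of `w`, then `w h_s` is a nonnegative combination of simple
roots. The element `w` is split as `v x` with `x` the longest possible alternating word in `s` and a
right descent `t`; then neither `s` nor `t` is a right descent of the shorter element `v`. -/
theorem dualAct_simpleRoot_nonneg (w : W) (s : B) (h : ¬ cs.IsRightDescent w s) (u : B) :
    0 ≤ rootCoeff (dualAct cs w (simpleRoot s)) u := by
  induction hn : cs.length w using Nat.strong_induction_on generalizing w s with
  | _ n ih =>
  by_cases hw : w = 1
  · subst hw
    rw [dualAct_one]
    exact (isPosRoot_simpleRoot (cs := cs) s).2 u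
  obtain ⟨t, ht⟩ := cs.exists_rightDescent_of_ne_one hw
  have hst : s ≠ t := fun e => h (e ▸ ht)
  let P : ℕ → Prop := fun k =>
    ∃ v, w = v * cs.wordProd (alternatingWord s t k) ∧ cs.length w = cs.length v + k
  have hP1 : P 1 := by
    refine ⟨w * cs.simple t, by simp [alternatingWord], ?_⟩
    have := cs.isRightDescent_iff.1 ht; omega
  have hP_down : ∀ k, P (k + 1) → P k := by
    rintro k ⟨v, hv, hl⟩
    rw [alternatingWord_succ', cs.wordProd_cons, ← mul_assoc] at hv
    refine ⟨_, hv, ?_⟩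
    have h1 := cs.length_mul_le (v * cs.simple (if Even k then t else s))
      (cs.wordProd (alternatingWord s t k))
    rw [← hv] at h1
    have h2 := cs.length_wordProd_le (alternatingWord s t k)
    rw [length_alternatingWord] at h2
    have h3 := cs.length_mul_simple v (if Even k then t else s)
    omega
  obtain ⟨k, hk1, ⟨v, hv, hl⟩, hk2⟩ : ∃ k, 1 ≤ k ∧ P k ∧ ¬ P (k + 1) := by
    by_contra! hcon
    have hall : ∀ k, 1 ≤ k → P k := fun k hk => by
      induction k, hk using Nat.le_induction with
      | base => exact hP1
      | succ k hk ihk => exact hcon k hk ihk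
    obtain ⟨v, -, hl⟩ := hall (cs.length w + 1) (by omega)
    omega
  have hkM : M s t = 0 ∨ k + 1 ≤ M s t := by
    by_contra! hcon
    obtain ⟨hM, hkM⟩ := hcon
    have hPM : P (M s t) := by
      have : ∀ j, j ≤ k → P (k - j) := fun j => by
        induction j with
        | zero => exact fun _ => ⟨v, hv, hl⟩
        | succ j ihj =>
          intro hj
          apply hP_down
          rw [show k - (j + 1) + 1 = k - j by omega]
          exact ihj (by omega)
      have h1 := this (k - M s t) (by omega)
      rwa [show k - (k - M s t) = M s t by omega] at h1
    obtain ⟨v', hv', hl'⟩ := hPM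
    obtain ⟨m, hm⟩ := Nat.exists_eq_succ_of_ne_zero hM
    have hb := cs.wordProd_braidWord_eq s t
    rw [braidWord, braidWord, M.symmetric t s] at hb
    rw [hb, hm, Nat.succ_eq_add_one, alternatingWord_succ, cs.wordProd_concat] at hv'
    apply h
    rw [IsRightDescent]
    have h1 : w * cs.simple s = v' * cs.wordProd (alternatingWord s t m) := by
      rw [hv']; simp [mul_assoc]
    have h2 := cs.length_mul_le v' (cs.wordProd (alternatingWord s t m))
    have h3 := cs.length_wordProd_le (alternatingWord s t m)
    rw [length_alternatingWord] at h3
    rw [h1]; omega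
  have hva : ¬ cs.IsRightDescent v (if Even k then s else t) := by
    intro hd
    rw [cs.isRightDescent_iff] at hd
    obtain ⟨j, rfl⟩ := Nat.exists_eq_succ_of_ne_zero (by omega : k ≠ 0)
    rw [Nat.succ_eq_add_one, alternatingWord_succ', cs.wordProd_cons, ← mul_assoc] at hv
    have he : (if Even (j + 1) then s else t) = (if Even j then t else s) := by
      by_cases hj : Even j <;> simp [Nat.even_add_one, hj]
    rw [Nat.succ_eq_add_one, he] at hd
    have h1 := cs.length_mul_le (v * cs.simple (if Even j then t else s))
      (cs.wordProd (alternatingWord s t j))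
    rw [← hv] at h1
    have h2 := cs.length_wordProd_le (alternatingWord s t j)
    rw [length_alternatingWord] at h2
    omega
  have hvb : ¬ cs.IsRightDescent v (if Even k then t else s) := by
    intro hd
    rw [cs.isRightDescent_iff] at hd
    refine hk2 ⟨v * cs.simple (if Even k then t else s), ?_, by omega⟩
    rw [alternatingWord_succ', cs.wordProd_cons, ← mul_assoc, mul_assoc v,
      cs.simple_mul_simple_self, mul_one, hv]
  rw [hv, dualAct_mul, dualAct_alternatingWord, map_add, map_smul, map_smul, rootCoeff_add,
    rootCoeff_smul, rootCoeff_smul]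
  have hU1 := chebyshev_U_nonneg (M := M) hst (k := k + 1) (by omega)
  have hU2 := chebyshev_U_nonneg (M := M) hst (k := k) (by omega)
  push_cast at hU1
  rw [add_sub_cancel_right] at hU1
  exact add_nonneg (mul_nonneg hU1 (ih _ (by omega) _ _ hva rfl))
    (mul_nonneg hU2 (ih _ (by omega) _ _ hvb rfl))

end Positivity

/-! ### Inversions and the Tits cone -/

section Inversions

variable {B W : Type*} [Fintype B] [DecidableEq B] [Group W] {M : CoxeterMatrix B}
  {cs : CoxeterSystem M W}

theorem isPosRoot_dualAct_of_not_isRightDescent {w : W} {s : B} (h : ¬ cs.IsRightDescent w s) :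
    IsPosRoot cs (dualAct cs w (simpleRoot s)) :=
  ⟨⟨w, s, rfl⟩, fun u => dualAct_simpleRoot_nonneg cs w s h u⟩

theorem isPosRoot_neg_dualAct_of_isRightDescent {w : W} {s : B} (h : cs.IsRightDescent w s) :
    IsPosRoot cs (-dualAct cs w (simpleRoot s)) := by
  have := isPosRoot_dualAct_of_not_isRightDescent
    (cs.isRightDescent_iff_not_isRightDescent_mul.1 h)
  rwa [dualAct_mul, dualAct_simple_simpleRoot, map_neg] at this

theorem IsRoot.pos_or_neg {φ : Dual ℝ (B → ℝ)} (h : IsRoot cs φ) :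
    IsPosRoot cs φ ∨ IsPosRoot cs (-φ) := by
  obtain ⟨w, s, rfl⟩ := h
  by_cases hd : cs.IsRightDescent w s
  · exact .inr (isPosRoot_neg_dualAct_of_isRightDescent hd)
  · exact .inl (isPosRoot_dualAct_of_not_isRightDescent hd)

theorem IsPosRoot.exists_rootCoeff_pos {φ : Dual ℝ (B → ℝ)} (h : IsPosRoot cs φ) :
    ∃ t, 0 < rootCoeff φ t := by
  by_contra! hcon
  refine h.1.ne_zero (dual_ext_rootCoeff fun t => ?_)
  rw [le_antisymm (hcon t) (h.2 t)]; rfl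

theorem IsPosRoot.not_neg {φ : Dual ℝ (B → ℝ)} (h : IsPosRoot cs φ) : ¬ IsPosRoot cs (-φ) := by
  intro h'
  obtain ⟨t, ht⟩ := h.exists_rootCoeff_pos
  have := h'.2 t
  rw [rootCoeff_neg] at this
  linarith

theorem isPosRoot_dualAct_iff {w : W} {s : B} :
    IsPosRoot cs (dualAct cs w (simpleRoot s)) ↔ ¬ cs.IsRightDescent w s :=
  ⟨fun h hd => h.not_neg (isPosRoot_neg_dualAct_of_isRightDescent hd),
    isPosRoot_dualAct_of_not_isRightDescent⟩

theorem IsPosRoot.apply_nonneg {φ : Dual ℝ (B → ℝ)} (h : IsPosRoot cs φ) {v : B → ℝ}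
    (hv : v ∈ fundChamber B) : 0 ≤ φ v := by
  rw [apply_eq_sum_rootCoeff]
  exact Finset.sum_nonneg fun t _ => mul_nonneg (h.2 t) (hv t)

theorem IsPosRoot.apply_pos {φ : Dual ℝ (B → ℝ)} (h : IsPosRoot cs φ) {v : B → ℝ}
    (hv : ∀ s, 0 < v s) : 0 < φ v := by
  obtain ⟨t, ht⟩ := h.exists_rootCoeff_pos
  rw [apply_eq_sum_rootCoeff]
  exact Finset.sum_pos' (fun t _ => mul_nonneg (h.2 t) (hv t).le)
    ⟨t, Finset.mem_univ _, mul_pos ht (hv t)⟩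

/-- A root is determined by its sign on the open fundamental chamber. -/
theorem IsRoot.isPosRoot_of_nonneg {φ : Dual ℝ (B → ℝ)} (h : IsRoot cs φ) {v : B → ℝ}
    (hv : ∀ s, 0 < v s) (h0 : 0 ≤ φ v) : IsPosRoot cs φ := by
  rcases h.pos_or_neg with h' | h'
  · exact h'
  · have := h'.apply_pos hv
    rw [LinearMap.neg_apply] at this
    linarith

/-- A simple reflection permutes the positive roots other than its own simple root. -/
theorem IsPosRoot.dualAct_simple {φ : Dual ℝ (B → ℝ)} (h : IsPosRoot cs φ) {s : B}
    (hs : φ ≠ simpleRoot s) : IsPosRoot cs (dualAct cs (cs.simple s) φ) := by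
  obtain ⟨t, hts, ht⟩ : ∃ t, s ≠ t ∧ 0 < rootCoeff φ t := by
    by_contra! hcon
    have hφ : φ = rootCoeff φ s • simpleRoot s := by
      refine dual_ext_rootCoeff fun t => ?_
      rw [rootCoeff_smul, rootCoeff_simpleRoot]
      split_ifs with hst
      · rw [hst, mul_one]
      · rw [mul_zero]; exact le_antisymm (hcon t hst) (h.2 t)
    have h1 := h.1.rootForm_self
    rw [hφ, rootForm_smul_left, rootForm_smul_right, rootForm_simpleRoot, rootVec_self, mul_one]
      at h1
    have h2 : rootCoeff φ s = 1 := by nlinarith [h.2 s]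
    rw [h2, one_smul] at hφ
    exact hs hφ
  rcases (h.1.dualAct (cs.simple s)).pos_or_neg with h' | h'
  · exact h'
  · have := h'.2 t
    rw [GreedyCoxeter.dualAct_simple, rootCoeff_neg, rootCoeff_sub, rootCoeff_smul,
      rootCoeff_simpleRoot, if_neg hts] at this
    linarith

theorem IsPosRoot.eq_simpleRoot {φ : Dual ℝ (B → ℝ)} (h : IsPosRoot cs φ) {s : B}
    (hs : IsPosRoot cs (-dualAct cs (cs.simple s) φ)) : φ = simpleRoot s := by
  by_contra hne
  exact (h.dualAct_simple hne).not_neg hs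

/-- The positive roots made negative by `w`. -/
def inversions (cs : CoxeterSystem M W) (w : W) : Set (Dual ℝ (B → ℝ)) :=
  {φ | IsPosRoot cs φ ∧ IsPosRoot cs (-dualAct cs w φ)}

theorem finite_inversions (w : W) : (inversions cs w).Finite := by
  induction w using cs.simple_induction_left with
  | one =>
    refine Set.finite_empty.subset fun φ ⟨h1, h2⟩ => ?_
    rw [dualAct_one] at h2
    exact h1.not_neg h2
  | mul_simple_left w s ih =>
    refine (ih.union (Set.finite_singleton (dualAct cs w⁻¹ (simpleRoot s)))).subset ?_
    rintro φ ⟨h1, h2⟩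
    rcases (h1.1.dualAct w).pos_or_neg with h' | h'
    · rw [dualAct_mul] at h2
      right
      rw [Set.mem_singleton_iff, ← h'.eq_simpleRoot h2, dualAct_inv_self]
    · exact .inl ⟨h1, h'⟩

/-- An element without inversions is trivial. -/
theorem eq_one_of_isPosRoot {w : W} (h : ∀ s, IsPosRoot cs (dualAct cs w (simpleRoot s))) :
    w = 1 := by
  by_contra hw
  obtain ⟨s, hs⟩ := cs.exists_rightDescent_of_ne_one hw
  exact isPosRoot_dualAct_iff.1 (h s) hs

/-- An element is determined by its inversions. -/
theorem inversions_injective : Function.Injective (inversions cs) := by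
  intro w w' h
  rw [← mul_inv_eq_one]
  refine eq_one_of_isPosRoot (cs := cs) fun s => ?_
  have hs := isPosRoot_simpleRoot (cs := cs) s
  rw [dualAct_mul]
  have hψ := hs.1.dualAct w'⁻¹
  have key : dualAct cs w' (dualAct cs w'⁻¹ (simpleRoot s)) = simpleRoot s := dualAct_self_inv ..
  generalize dualAct cs w'⁻¹ (simpleRoot s) = ψ at hψ key ⊢
  rcases hψ.pos_or_neg with h1 | h1
  · rcases (hψ.dualAct w).pos_or_neg with h2 | h2
    · exact h2
    · have : ψ ∈ inversions cs w' := h ▸ ⟨h1, h2⟩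
      exact absurd this.2 (by rw [key]; exact hs.not_neg)
  · have : -ψ ∈ inversions cs w := by
      rw [h]
      exact ⟨h1, by rw [map_neg, neg_neg, key]; exact hs⟩
    simpa using this.2

/-- A point on which only finitely many positive roots are negative can be moved into the
fundamental chamber. -/
theorem exists_geomRep_mem_fundChamber {y : B → ℝ}
    (hy : {φ | IsPosRoot cs φ ∧ φ y < 0}.Finite) :
    ∃ w : W, geomRep cs w y ∈ fundChamber B := by
  induction hn : {φ | IsPosRoot cs φ ∧ φ y < 0}.ncard using Nat.strong_induction_on
    generalizing y with
  | _ n ih =>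
  by_cases hC : y ∈ fundChamber B
  · exact ⟨1, by rwa [geomRep_one_apply]⟩
  obtain ⟨s, hs⟩ : ∃ s, y s < 0 := by
    simpa [fundChamber] using hC
  have hmem : simpleRoot s ∈ {φ | IsPosRoot cs φ ∧ φ y < 0} := ⟨isPosRoot_simpleRoot s, hs⟩
  have hsub : {φ | IsPosRoot cs φ ∧ φ (geomRep cs (cs.simple s) y) < 0} ⊆
      dualAct cs (cs.simple s) '' ({φ | IsPosRoot cs φ ∧ φ y < 0} \ {simpleRoot s}) := by
    rintro φ ⟨h1, h2⟩
    have hsφ : dualAct cs (cs.simple s) φ y = φ (geomRep cs (cs.simple s) y) := by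
      rw [dualAct_apply, cs.inv_simple]
    have hne : φ ≠ simpleRoot s := by
      rintro rfl
      rw [← hsφ, dualAct_simple_simpleRoot] at h2
      simp at h2
      linarith
    refine ⟨dualAct cs (cs.simple s) φ, ⟨⟨h1.dualAct_simple hne, ?_⟩, ?_⟩, ?_⟩
    · rwa [hsφ]
    · intro he
      rw [Set.mem_singleton_iff] at he
      have : φ = -simpleRoot s := by
        rw [← dualAct_simple_simpleRoot cs, ← he, ← dualAct_mul, cs.simple_mul_simple_self,
          dualAct_one]
      rw [this] at h1
      exact (isPosRoot_simpleRoot s).not_neg h1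
    · rw [← dualAct_mul, cs.simple_mul_simple_self, dualAct_one]
  have hfin := hy.sdiff (t := {simpleRoot s}) |>.image (dualAct cs (cs.simple s))
  have hlt : {φ | IsPosRoot cs φ ∧ φ (geomRep cs (cs.simple s) y) < 0}.ncard < n := by
    refine ((Set.ncard_le_ncard hsub hfin).trans
      (Set.ncard_image_le hy.sdiff)).trans_lt ?_
    rw [← hn]
    exact Set.ncard_sdiff_singleton_lt_of_mem hmem hy
  obtain ⟨w, hw⟩ := ih _ hlt (hfin.subset hsub) rfl
  exact ⟨w * cs.simple s, by rwa [geomRep_mul_apply]⟩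

/-- The Tits cone consists of the points on which only finitely many positive roots are
negative. -/
theorem mem_titsCone_iff {v : B → ℝ} :
    v ∈ titsCone cs ↔ {φ | IsPosRoot cs φ ∧ φ v < 0}.Finite := by
  constructor
  · intro h
    obtain ⟨w, x, hx, rfl⟩ := Set.mem_iUnion.1 h
    refine (finite_inversions (cs := cs) w⁻¹).subset ?_
    rintro φ ⟨h1, h2⟩
    refine ⟨h1, ?_⟩
    rcases (h1.1.dualAct w⁻¹).pos_or_neg with h' | h'
    · have := h'.apply_nonneg hx
      rw [dualAct_apply, inv_inv] at this
      linarith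
    · exact h'
  · intro h
    obtain ⟨w, hw⟩ := exists_geomRep_mem_fundChamber h
    exact Set.mem_iUnion.2 ⟨w⁻¹, _, hw, by simp⟩

theorem fundChamber_subset_titsCone : fundChamber B ⊆ titsCone cs := fun v hv =>
  Set.mem_iUnion.2 ⟨1, v, hv, by simp⟩

theorem geomRep_mem_titsCone (w : W) {v : B → ℝ} (hv : v ∈ titsCone cs) :
    geomRep cs w v ∈ titsCone cs := by
  obtain ⟨w', x, hx, rfl⟩ := Set.mem_iUnion.1 hv
  exact Set.mem_iUnion.2 ⟨w * w', x, hx, by simp⟩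

@[simp] theorem geomRep_mem_titsCone_iff (w : W) {v : B → ℝ} :
    geomRep cs w v ∈ titsCone cs ↔ v ∈ titsCone cs :=
  ⟨fun h => by simpa using geomRep_mem_titsCone w⁻¹ h, geomRep_mem_titsCone w⟩

theorem titsCone_add {u v : B → ℝ} (hu : u ∈ titsCone cs) (hv : v ∈ titsCone cs) :
    u + v ∈ titsCone cs := by
  rw [mem_titsCone_iff] at *
  refine (hu.union hv).subset ?_
  rintro φ ⟨h1, h2⟩
  rw [map_add] at h2
  rcases lt_or_ge (φ u) 0 with h | h
  · exact .inl ⟨h1, h⟩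
  · exact .inr ⟨h1, by linarith⟩

theorem titsCone_smul {c : ℝ} (hc : 0 < c) {v : B → ℝ} (hv : v ∈ titsCone cs) :
    c • v ∈ titsCone cs := by
  rw [mem_titsCone_iff] at *
  refine hv.subset ?_
  rintro φ ⟨h1, h2⟩
  rw [map_smul, smul_eq_mul] at h2
  exact ⟨h1, by by_contra! h; nlinarith⟩

/-- Only finitely many roots separate two points of the Tits cone. -/
theorem finite_separating {u v : B → ℝ} (hu : u ∈ titsCone cs) (hv : v ∈ titsCone cs) :
    {φ | IsRoot cs φ ∧ 0 < φ u ∧ φ v < 0}.Finite := by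
  rw [mem_titsCone_iff] at hu hv
  refine (hv.union (hu.image Neg.neg)).subset ?_
  rintro φ ⟨h1, h2, h3⟩
  rcases h1.pos_or_neg with h | h
  · exact .inl ⟨h, h3⟩
  · exact .inr ⟨-φ, ⟨h, by simpa using h2⟩, neg_neg φ⟩

end Inversions

/-! ### Pairs of roots -/

section Pairs

variable {B W : Type*} [Fintype B] [DecidableEq B] [Group W] {M : CoxeterMatrix B}
  {cs : CoxeterSystem M W}

/-- The closed half-space of the Tits cone where a functional is nonnegative. -/
def halfOf (cs : CoxeterSystem M W) (φ : Dual ℝ (B → ℝ)) : Set (B → ℝ) :=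
  {v ∈ titsCone cs | 0 ≤ φ v}

/-- Two roots `α`, `β` with `B(α, β) ≥ 1` have nested half-spaces. Otherwise there are points `u`
and `v` of the Tits cone with `β(u) < 0 ≤ α(u)` and `α(v) < 0 ≤ β(v)`. The reflections in `α`
and `β` generate infinitely many roots `p α - q β` with `p > q > 0`, and all of them separate `u`
from `v`. -/
theorem halfOf_subset_or_subset {α β : Dual ℝ (B → ℝ)} (hα : IsRoot cs α) (hβ : IsRoot cs β)
    (h : 1 ≤ rootForm M α β) : halfOf cs α ⊆ halfOf cs β ∨ halfOf cs β ⊆ halfOf cs α := by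
  by_contra! hcon
  obtain ⟨h1, h2⟩ := hcon
  obtain ⟨u, ⟨huU, huα⟩, hu⟩ := Set.not_subset.1 h1
  obtain ⟨v, ⟨hvU, hvβ⟩, hv⟩ := Set.not_subset.1 h2
  have huβ : β u < 0 := by by_contra! h'; exact hu ⟨huU, h'⟩
  have hvα : α v < 0 := by by_contra! h'; exact hv ⟨hvU, h'⟩
  obtain ⟨a, ha⟩ := hα.exists_reflection
  obtain ⟨b, hb⟩ := hβ.exists_reflection
  have hex : ∀ n : ℕ, ∃ p q : ℝ, IsRoot cs (p • α - q • β) ∧ n ≤ q ∧ q + 1 ≤ p := by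
    intro n
    induction n with
    | zero => exact ⟨1, 0, by simpa using hα, by simp, by simp⟩
    | succ n ih =>
      obtain ⟨p, q, hr, hq, hp⟩ := ih
      have hn : (0 : ℝ) ≤ n := n.cast_nonneg
      have hr' := (hr.dualAct b).dualAct a
      set c := rootForm M α β with hc
      have key : dualAct cs a (dualAct cs b (p • α - q • β)) =
          (2 * c * (2 * c * p - q) - p) • α - (2 * c * p - q) • β := by
        simp only [ha, hb, hα.rootForm_self, hβ.rootForm_self, rootForm_symm β α, ← hc,
          rootForm_sub_left, rootForm_smul_left]
        module
      rw [key] at hr'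
      refine ⟨_, _, hr', ?_, ?_⟩
      · push_cast; nlinarith
      · have hq' : p + 1 ≤ 2 * c * p - q := by nlinarith
        nlinarith
  obtain ⟨K, hK⟩ := ((finite_separating huU hvU).image fun φ => φ u).bddAbove
  obtain ⟨n, hn⟩ := exists_nat_gt (max 1 (K / (-β u)))
  obtain ⟨p, q, hr, hq, hp⟩ := hex n
  have hn1 : 1 < q := (le_max_left _ _).trans_lt (hn.trans_le hq)
  have hn2 : K / (-β u) < q := (le_max_right _ _).trans_lt (hn.trans_le hq)
  rw [div_lt_iff₀ (by linarith)] at hn2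
  have hu1 : (p • α - q • β) u = p * α u + q * (-β u) := by simp; ring
  have hv1 : (p • α - q • β) v = p * α v + q * (-β v) := by simp; ring
  have hpα : 0 ≤ p * α u := mul_nonneg (by linarith) huα
  have := hK ⟨p • α - q • β, ⟨hr, by rw [hu1]; nlinarith, by rw [hv1]; nlinarith⟩, rfl⟩
  simp only [hu1] at this
  linarith

/-- If `g` acts modulo the kernel of `L` as a root of `X² - t X + 1` with `t < 2`, then every convex
cone that is stable under `g` and nonempty meets the kernel of `L`. If `t ≤ 0`, the point
`g² x - t g x + x` will do; otherwise `g²` is a root of `X² - (t² - 2) X + 1`, and `2 - t` at least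
doubles on passing from `g` to `g²`. -/
theorem exists_mem_ker_of_quadratic {V E : Type*} [AddCommGroup V] [Module ℝ V] [AddCommGroup E]
    [Module ℝ E] {X : Set V} (hadd : ∀ x ∈ X, ∀ y ∈ X, x + y ∈ X)
    (hsmul : ∀ c : ℝ, 0 < c → ∀ x ∈ X, c • x ∈ X) (hne : X.Nonempty) (L : V →ₗ[ℝ] E)
    {g : V → V} (hg : ∀ x ∈ X, g x ∈ X) {t : ℝ} (ht : t < 2)
    (hq : ∀ v, L (g (g v)) - t • L (g v) + L v = 0) : ∃ y ∈ X, L y = 0 := by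
  obtain ⟨n, hn⟩ : ∃ n : ℕ, 2 ≤ 2 ^ n * (2 - t) := by
    obtain ⟨n, hn⟩ := pow_unbounded_of_one_lt (2 / (2 - t)) (by norm_num : (1 : ℝ) < 2)
    exact ⟨n, by rw [div_lt_iff₀ (by linarith)] at hn; exact hn.le⟩
  have hbase : ∀ (g : V → V) (t : ℝ), (∀ x ∈ X, g x ∈ X) → t ≤ 0 →
      (∀ v, L (g (g v)) - t • L (g v) + L v = 0) → ∃ y ∈ X, L y = 0 := by
    intro g t hg ht0 hq
    obtain ⟨x, hx⟩ := hne
    rcases ht0.eq_or_lt with rfl | ht0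
    · exact ⟨_, hadd _ (hg _ (hg _ hx)) _ hx, by simpa using hq x⟩
    · refine ⟨_, hadd _ (hadd _ (hg _ (hg _ hx)) _ (hsmul (-t) (by linarith) _ (hg _ hx))) _ hx, ?_⟩
      simpa [sub_eq_add_neg] using hq x
  induction n generalizing g t with
  | zero => exact hbase g t hg (by linarith) hq
  | succ n ih =>
    rcases le_or_gt t 0 with ht0 | ht0
    · exact hbase g t hg ht0 hq
    refine ih (g := g ∘ g) (t := t ^ 2 - 2) (fun x hx => hg _ (hg _ hx)) (by nlinarith) ?_ ?_
    · intro v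
      have h1 := hq (g (g v))
      have h2 := congrArg (t • ·) (hq (g v))
      have h3 := hq v
      simp only [smul_zero] at h2
      have := congrArg₂ (· + ·) (congrArg₂ (· + ·) h1 h2) h3
      simp only [add_zero] at this
      rw [← this, Function.comp, Function.comp]
      module
    · rw [pow_succ] at hn
      have : 2 * (2 - t) ≤ 2 - (t ^ 2 - 2) := by nlinarith
      nlinarith [pow_pos (by norm_num : (0 : ℝ) < 2) n]

/-- The positive roots with support in `J`. -/
def posRootsIn (cs : CoxeterSystem M W) (J : Set B) : Set (Dual ℝ (B → ℝ)) :=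
  {φ | IsPosRoot cs φ ∧ ∀ t ∉ J, rootCoeff φ t = 0}

/-- Two roots `α`, `β` with `|B(α, β)| < 1` can be moved simultaneously to roots supported in a set
`J` that supports only finitely many positive roots: both vanish at some interior point of the Tits
cone. -/
theorem exists_finite_support {α β : Dual ℝ (B → ℝ)} (hα : IsRoot cs α) (hβ : IsRoot cs β)
    (h : |rootForm M α β| < 1) : ∃ (w : W) (J : Set B), (posRootsIn cs J).Finite ∧
      (∀ t ∉ J, rootCoeff (dualAct cs w α) t = 0) ∧
      (∀ t ∉ J, rootCoeff (dualAct cs w β) t = 0) := by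
  let X : Set (B → ℝ) := {y | {φ | IsPosRoot cs φ ∧ φ y ≤ 0}.Finite}
  have hW : ∀ w : W, ∀ x ∈ X, geomRep cs w x ∈ X := by
    intro w x hx
    refine ((hx.image (dualAct cs w)).union (finite_inversions (cs := cs) w⁻¹)).subset ?_
    rintro φ ⟨h1, h2⟩
    rcases (h1.1.dualAct w⁻¹).pos_or_neg with h' | h'
    · exact .inl ⟨_, ⟨h', by rwa [dualAct_apply, inv_inv]⟩, by simp⟩
    · exact .inr ⟨h1, h'⟩
  obtain ⟨a, ha⟩ := hα.exists_reflection
  obtain ⟨b, hb⟩ := hβ.exists_reflection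
  -- Modulo `ker α ∩ ker β`, the product of the two reflections has determinant `1` and trace
  -- `4 c² - 2 < 2`. The set `X`, the interior of the Tits cone, is a `W`-stable convex cone.
  set c := rootForm M α β with hc
  obtain ⟨hc1, hc2⟩ := abs_lt.1 h
  obtain ⟨y, hyX, hy⟩ := exists_mem_ker_of_quadratic (X := X)
    (fun x hx y hy => (hx.union hy).subset fun φ ⟨h1, h2⟩ => by
      rw [map_add] at h2
      rcases le_or_gt (φ x) 0 with h | h
      · exact .inl ⟨h1, h⟩
      · exact .inr ⟨h1, by linarith⟩)
    (fun c hc x hx => hx.subset fun φ ⟨h1, h2⟩ => ⟨h1, by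
      rw [map_smul, smul_eq_mul] at h2
      by_contra! h
      nlinarith⟩)
    ⟨fun _ => 1, by
      refine Set.finite_empty.subset fun φ ⟨h1, h2⟩ => ?_
      have := h1.apply_pos (v := fun _ => 1) (by simp)
      linarith⟩
    (α.prod β) (g := geomRep cs (a * b)⁻¹) (hW _) (t := 4 * c ^ 2 - 2) (by nlinarith)
    (fun v => by
      have hab : ∀ φ : Dual ℝ (B → ℝ), ∀ v, φ (geomRep cs (a * b)⁻¹ v) =
          dualAct cs a (dualAct cs b φ) v := fun φ v => by rw [← dualAct_mul]; rfl
      refine Prod.ext ?_ ?_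
      · change α _ - (4 * c ^ 2 - 2) * α _ + α v = 0
        simp only [hab, ha, hb, hα.rootForm_self, hβ.rootForm_self, ← hc, LinearMap.sub_apply,
          LinearMap.smul_apply, smul_eq_mul, rootForm_sub_left, rootForm_smul_left,
          rootForm_symm β α]
        ring
      · change β _ - (4 * c ^ 2 - 2) * β _ + β v = 0
        simp only [hab, ha, hb, hβ.rootForm_self, hα.rootForm_self, ← hc, LinearMap.sub_apply,
          LinearMap.smul_apply, smul_eq_mul, rootForm_sub_left, rootForm_smul_left,
          rootForm_symm β α]
        ring)
  obtain ⟨w, hw⟩ := exists_geomRep_mem_fundChamber (cs := cs) (y := y)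
    (hyX.subset fun φ ⟨h1, h2⟩ => ⟨h1, h2.le⟩)
  replace hy : α y = 0 ∧ β y = 0 := Prod.mk_eq_zero.1 hy
  have hsupp : ∀ φ, IsRoot cs φ → φ (geomRep cs w y) = 0 →
      ∀ t ∉ {s | geomRep cs w y s = 0}, rootCoeff φ t = 0 := by
    have hpos : ∀ φ, IsPosRoot cs φ → φ (geomRep cs w y) = 0 →
        ∀ t ∉ {s | geomRep cs w y s = 0}, rootCoeff φ t = 0 := by
      intro φ hφ h0 t ht
      rw [apply_eq_sum_rootCoeff, Finset.sum_eq_zero_iff_of_nonneg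
        (fun t _ => mul_nonneg (hφ.2 t) (hw t))] at h0
      exact (mul_eq_zero.1 (h0 t (Finset.mem_univ t))).resolve_right ht
    intro φ hφ h0 t ht
    rcases hφ.pos_or_neg with h' | h'
    · exact hpos φ h' h0 t ht
    · simpa using hpos _ h' (by simpa using h0) t ht
  refine ⟨w, {s | geomRep cs w y s = 0}, (hW w y hyX).subset ?_,
    hsupp _ (hα.dualAct w) (by rw [dualAct_geomRep, hy.1]),
    hsupp _ (hβ.dualAct w) (by rw [dualAct_geomRep, hy.2])⟩
  rintro φ ⟨h1, h2⟩
  refine ⟨h1, le_of_eq ?_⟩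
  rw [apply_eq_sum_rootCoeff]
  refine Finset.sum_eq_zero fun t _ => ?_
  by_cases ht : geomRep cs w y t = 0
  · rw [ht, mul_zero]
  · rw [h2 t ht, zero_mul]

/-- The form takes only finitely many values in `(-1, 1)` on pairs of roots. -/
theorem finite_rootForm_values (cs : CoxeterSystem M W) :
    {c : ℝ | |c| < 1 ∧ ∃ α β, IsRoot cs α ∧ IsRoot cs β ∧ rootForm M α β = c}.Finite := by
  classical
  let R : Set B → Set (Dual ℝ (B → ℝ)) := fun J =>
    if (posRootsIn cs J).Finite then posRootsIn cs J ∪ Neg.neg '' posRootsIn cs J else ∅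
  have hR : ∀ J, (R J).Finite := fun J => by
    by_cases h : (posRootsIn cs J).Finite
    · simpa only [R, h, if_true] using h.union (h.image _)
    · simp [R, h]
  refine (Set.finite_iUnion fun J : Set B => (hR J).image2 (rootForm M) (hR J)).subset ?_
  rintro c ⟨hc, α, β, hα, hβ, rfl⟩
  obtain ⟨w, J, hJ, h1, h2⟩ := exists_finite_support hα hβ hc
  have hmem : ∀ φ, IsRoot cs φ → (∀ t ∉ J, rootCoeff φ t = 0) → φ ∈ R J := by
    intro φ hφ h
    simp only [R, hJ, if_true]
    rcases hφ.pos_or_neg with h' | h'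
    · exact .inl ⟨h', h⟩
    · exact .inr ⟨-φ, ⟨h', fun t ht => by simp [h t ht]⟩, neg_neg φ⟩
  refine Set.mem_iUnion.2 ⟨J, _, hmem _ (hα.dualAct w) h1, _, hmem _ (hβ.dualAct w) h2, ?_⟩
  rw [rootForm_dualAct]

end Pairs

/-! ### Finiteness of the set of minimal roots -/

section MinimalRoots

variable {B W : Type*} [Fintype B] [DecidableEq B] [Group W] {M : CoxeterMatrix B}
  {cs : CoxeterSystem M W}

theorem geomRep_mem_halfOf_dualAct (w : W) {φ : Dual ℝ (B → ℝ)} {v : B → ℝ} :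
    geomRep cs w v ∈ halfOf cs (dualAct cs w φ) ↔ v ∈ halfOf cs φ := by
  simp [halfOf]

theorem mem_halfOf_dualAct (w : W) {φ : Dual ℝ (B → ℝ)} {v : B → ℝ} :
    v ∈ halfOf cs (dualAct cs w φ) ↔ geomRep cs w⁻¹ v ∈ halfOf cs φ := by
  rw [← geomRep_mem_halfOf_dualAct w (φ := φ), geomRep_apply_inv_self]

theorem halfOf_dualAct_subset (w : W) {φ ψ : Dual ℝ (B → ℝ)} (h : halfOf cs φ ⊆ halfOf cs ψ) :
    halfOf cs (dualAct cs w φ) ⊆ halfOf cs (dualAct cs w ψ) := fun v hv => by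
  rw [mem_halfOf_dualAct] at hv ⊢
  exact h hv

theorem IsPosRoot.fundChamber_subset_halfOf {φ : Dual ℝ (B → ℝ)} (h : IsPosRoot cs φ) :
    fundChamber B ⊆ halfOf cs φ :=
  fun _ hv => ⟨fundChamber_subset_titsCone hv, h.apply_nonneg hv⟩

theorem one_mem_titsCone (cs : CoxeterSystem M W) : (fun _ => 1 : B → ℝ) ∈ titsCone cs :=
  fundChamber_subset_titsCone fun _ => zero_le_one

/-- Simple roots are minimal for inclusion of half-spaces. -/
theorem IsPosRoot.eq_simpleRoot_of_halfOf_subset {φ : Dual ℝ (B → ℝ)} (h : IsPosRoot cs φ) {s : B}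
    (hs : halfOf cs φ ⊆ halfOf cs (simpleRoot s)) : φ = simpleRoot s := by
  by_contra hne
  have h1 := (h.dualAct_simple hne).apply_pos (v := fun _ => 1) (by simp)
  rw [dualAct_apply] at h1
  have h2 := (hs ⟨geomRep_mem_titsCone _ (one_mem_titsCone cs), h1.le⟩).2
  rw [← dualAct_apply, dualAct_simple_simpleRoot] at h2
  simp at h2
  linarith

/-- A root is determined by its half-space. -/
theorem halfOf_injOn : Set.InjOn (halfOf cs) {φ | IsRoot cs φ} := by
  rintro φ hφ _ ⟨w, s, rfl⟩ h
  have h1 : halfOf cs (dualAct cs w⁻¹ φ) = halfOf cs (simpleRoot s) := by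
    ext v
    rw [mem_halfOf_dualAct, inv_inv, h, geomRep_mem_halfOf_dualAct]
  have h2 : (fun _ => 1 : B → ℝ) ∈ halfOf cs (dualAct cs w⁻¹ φ) := by
    rw [h1]
    exact ⟨one_mem_titsCone cs, zero_le_one⟩
  have h3 := ((hφ.dualAct w⁻¹).isPosRoot_of_nonneg (by simp) h2.2).eq_simpleRoot_of_halfOf_subset
    h1.subset
  rw [← h3, dualAct_self_inv]

/-- A minimal (also called elementary, or small) root: a positive root whose half-space contains the
half-space of no other positive root. -/
def IsMinRoot (cs : CoxeterSystem M W) (φ : Dual ℝ (B → ℝ)) : Prop :=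
  IsPosRoot cs φ ∧ ∀ ψ, IsPosRoot cs ψ → halfOf cs ψ ⊆ halfOf cs φ → ψ = φ

theorem isMinRoot_simpleRoot (s : B) : IsMinRoot cs (simpleRoot s) :=
  ⟨isPosRoot_simpleRoot s, fun _ h => h.eq_simpleRoot_of_halfOf_subset⟩

theorem IsMinRoot.eq_of_one_le_rootForm {φ ψ : Dual ℝ (B → ℝ)} (hφ : IsMinRoot cs φ)
    (hψ : IsMinRoot cs ψ) (h : 1 ≤ rootForm M φ ψ) : φ = ψ := by
  rcases halfOf_subset_or_subset hφ.1.1 hψ.1.1 h with h | h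
  · exact hψ.2 _ hφ.1 h
  · exact (hφ.2 _ hψ.1 h).symm

/-- Reflecting a minimal root towards the simple roots gives a minimal root. -/
theorem IsMinRoot.dualAct_simple {φ : Dual ℝ (B → ℝ)} (h : IsMinRoot cs φ) {s : B}
    (hs : φ ≠ simpleRoot s) (h0 : 0 < rootForm M φ (simpleRoot s)) :
    IsMinRoot cs (dualAct cs (cs.simple s) φ) := by
  have hinv : ∀ ψ, dualAct cs (cs.simple s) (dualAct cs (cs.simple s) ψ) = ψ := fun ψ => by
    rw [← dualAct_mul, cs.simple_mul_simple_self, dualAct_one]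
  refine ⟨h.1.dualAct_simple hs, fun ψ hψ hsub => ?_⟩
  by_cases hψs : ψ = simpleRoot s
  · subst hψs
    refine absurd (h.2 _ hψ fun v hv => ⟨hv.1, ?_⟩).symm hs
    have h1 := (hsub hv).2
    rw [dualAct_simple', LinearMap.sub_apply, LinearMap.smul_apply, smul_eq_mul] at h1
    have h2 := mul_nonneg (by linarith : 0 ≤ 2 * rootForm M φ (simpleRoot s)) hv.2
    linarith
  · have h1 := halfOf_dualAct_subset (cs.simple s) hsub
    rw [hinv] at h1
    rw [← h.2 _ (hψ.dualAct_simple hψs) h1, hinv]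

theorem IsPosRoot.exists_rootForm_pos {φ : Dual ℝ (B → ℝ)} (h : IsPosRoot cs φ) :
    ∃ s, 0 < rootForm M φ (simpleRoot s) := by
  by_contra! hcon
  have h1 := h.1.rootForm_self
  rw [rootForm_eq_sum_coeff] at h1
  have : ∑ t, rootCoeff φ t * rootForm M φ (simpleRoot t) ≤ 0 :=
    Finset.sum_nonpos fun t _ => mul_nonpos_of_nonneg_of_nonpos (h.2 t) (hcon t)
  linarith

/-- The values of the form on `φ` and the simple roots, truncated below at `-1`. -/
noncomputable def truncatedGram (M : CoxeterMatrix B) (φ : Dual ℝ (B → ℝ)) (s : B) : ℝ :=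
  max (-1) (rootForm M φ (simpleRoot s))

theorem finite_truncatedGram (cs : CoxeterSystem M W) :
    (truncatedGram M '' {φ | IsMinRoot cs φ}).Finite := by
  refine (Set.Finite.pi' fun _ : B => ((finite_rootForm_values cs).union
    (Set.toFinite {-1, 1}))).subset ?_
  rintro _ ⟨φ, hφ, rfl⟩ s
  rw [truncatedGram]
  rcases le_or_gt (rootForm M φ (simpleRoot s)) (-1) with h1 | h1
  · rw [max_eq_left h1]; simp
  rw [max_eq_right h1.le]
  rcases lt_or_ge (rootForm M φ (simpleRoot s)) 1 with h2 | h2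
  · exact .inl ⟨abs_lt.2 ⟨h1, h2⟩, _, _, hφ.1.1, isRoot_simpleRoot s, rfl⟩
  · rw [hφ.eq_of_one_le_rootForm (isMinRoot_simpleRoot s) h2, rootForm_simpleRoot, rootVec_self]
    simp

theorem rootForm_simpleRoot_nonpos {φ : Dual ℝ (B → ℝ)} (h : ∀ t, 0 ≤ rootCoeff φ t) {s : B}
    (hs : rootCoeff φ s = 0) : rootForm M φ (simpleRoot s) ≤ 0 := by
  rw [rootForm_eq_sum]
  refine Finset.sum_nonpos fun t _ => ?_
  by_cases hts : t = s
  · rw [hts, hs, zero_mul]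
  · exact mul_nonpos_of_nonneg_of_nonpos (h t) (rootVec_nonpos M hts)

/-- `ψ` is obtained from the minimal root `φ` by a simple reflection that lowers it. -/
def MinStep (cs : CoxeterSystem M W) (φ ψ : Dual ℝ (B → ℝ)) : Prop :=
  IsMinRoot cs φ ∧ IsMinRoot cs ψ ∧ ∃ s, 0 < rootForm M φ (simpleRoot s) ∧
    rootForm M φ (simpleRoot s) < 1 ∧ ψ = dualAct cs (cs.simple s) φ

theorem IsMinRoot.exists_minStep {φ : Dual ℝ (B → ℝ)} (h : IsMinRoot cs φ)
    (hs : ∀ s, φ ≠ simpleRoot s) : ∃ ψ, MinStep cs φ ψ := by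
  obtain ⟨s, h0⟩ := h.1.exists_rootForm_pos
  refine ⟨_, h, h.dualAct_simple (hs s) h0, s, h0, ?_, rfl⟩
  by_contra! h1
  exact hs s (h.eq_of_one_le_rootForm (isMinRoot_simpleRoot s) h1)

/-- Truncated Gram vectors do not repeat along a descending chain of minimal roots. Let `γ` be the
difference of two terms of the chain with the same truncated Gram vector. A simple root `h_t` whose
entry is `-1` never occurs in `γ`: it could only be added at a stage where its entry exceeds `-1`,
while adding other simple roots lowers that entry further. All other simple roots are orthogonal to
`γ`, so `B(γ, γ) = 0`, and the two terms have inner product `1`; being minimal, they are equal. -/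
theorem truncatedGram_ne_of_chain {f : ℕ → Dual ℝ (B → ℝ)} {i j : ℕ} (hij : i < j)
    (hf : ∀ k < j, MinStep cs (f k) (f (k + 1))) :
    truncatedGram M (f i) ≠ truncatedGram M (f j) := by
  intro hg
  have key : ∀ d k, k + d = j →
      (∀ t, 0 ≤ rootCoeff (f k - f j) t) ∧
      (∀ t, rootForm M (f j) (simpleRoot t) ≤ -1 → rootCoeff (f k - f j) t = 0) ∧
      (0 < d → ∃ t, 0 < rootCoeff (f k - f j) t) := by
    intro d
    induction d with
    | zero =>
      rintro k rfl
      simp [rootCoeff]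
    | succ d ih =>
      intro k hk
      obtain ⟨ih1, ih2, -⟩ := ih (k + 1) (by omega)
      obtain ⟨-, -, s, hs0, hs1, hs⟩ := hf k (by omega)
      set b := rootForm M (f k) (simpleRoot s) with hb
      have hk1 : f k - f j = (f (k + 1) - f j) + (2 * b) • simpleRoot s := by
        rw [hs, dualAct_simple']; abel
      have hbs : rootForm M (f (k + 1)) (simpleRoot s) = -b := by
        rw [hs, dualAct_simple', rootForm_sub_left, rootForm_smul_left, rootForm_simpleRoot,
          rootVec_self]
        ring
      have hsJ : ¬ rootForm M (f j) (simpleRoot s) ≤ -1 := by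
        intro hJ
        have := rootForm_simpleRoot_nonpos (M := M) ih1 (ih2 s hJ)
        rw [rootForm_sub_left, hbs] at this
        linarith
      refine ⟨fun t => ?_, fun t ht => ?_, fun _ => ⟨s, ?_⟩⟩
      · rw [hk1, rootCoeff_add, rootCoeff_smul, rootCoeff_simpleRoot]
        have := ih1 t
        split_ifs <;> linarith
      · have hst : s ≠ t := by rintro rfl; exact hsJ ht
        rw [hk1, rootCoeff_add, rootCoeff_smul, rootCoeff_simpleRoot, if_neg hst, ih2 t ht]
        simp
      · rw [hk1, rootCoeff_add, rootCoeff_smul, rootCoeff_simpleRoot, if_pos rfl]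
        have := ih1 s
        linarith
  obtain ⟨h1, h2, h3⟩ := key (j - i) i (by omega)
  have hmi : IsMinRoot cs (f i) := (hf i hij).1
  have hmj : IsMinRoot cs (f j) := by
    obtain ⟨m, rfl⟩ := Nat.exists_eq_succ_of_ne_zero (by omega : j ≠ 0)
    exact (hf m (by omega)).2.1
  have hzero : rootForm M (f i - f j) (f i - f j) = 0 := by
    rw [rootForm_eq_sum_coeff]
    refine Finset.sum_eq_zero fun t _ => ?_
    by_cases ht : rootForm M (f j) (simpleRoot t) ≤ -1
    · rw [h2 t ht, zero_mul]
    · have hgt := congrFun hg t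
      simp only [truncatedGram] at hgt
      rw [max_eq_right (not_le.1 ht).le] at hgt
      have : rootForm M (f i) (simpleRoot t) = rootForm M (f j) (simpleRoot t) := by
        rcases max_choice (-1) (rootForm M (f i) (simpleRoot t)) with h | h
        · rw [h] at hgt; exact absurd hgt.symm.le ht
        · rwa [h] at hgt
      rw [rootForm_sub_left, this, sub_self, mul_zero]
  have hB : rootForm M (f i) (f j) = 1 := by
    rw [rootForm_sub_left, rootForm_sub_right, rootForm_sub_right, hmi.1.1.rootForm_self,
      hmj.1.1.rootForm_self, rootForm_symm (f j)] at hzero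
    linarith
  obtain ⟨t, ht⟩ := h3 (by omega)
  rw [hmi.eq_of_one_le_rootForm hmj hB.ge, sub_self] at ht
  simp [rootCoeff] at ht

/-- The **Brink–Howlett theorem**: a Coxeter group of finite rank has finitely many minimal roots. -/
theorem finite_isMinRoot (cs : CoxeterSystem M W) : {φ | IsMinRoot cs φ}.Finite := by
  -- The roots obtained from simple roots by at most `n` simple reflections.
  let lv : ℕ → Set (Dual ℝ (B → ℝ)) := fun n => Nat.rec (Set.range simpleRoot)
    (fun _ S => S ∪ ⋃ s, dualAct cs (cs.simple s) '' S) n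
  have hlv : ∀ n, (lv n).Finite := fun n => by
    induction n with
    | zero => exact Set.finite_range _
    | succ n ih => exact ih.union (Set.finite_iUnion fun s => ih.image _)
  have hchain : ∀ n φ, IsMinRoot cs φ → φ ∈ lv n ∨ ∃ f : ℕ → Dual ℝ (B → ℝ), f 0 = φ ∧
      ∀ k < n + 1, MinStep cs (f k) (f (k + 1)) := by
    intro n
    induction n with
    | zero =>
      intro φ hφ
      by_cases hs : ∃ s, simpleRoot s = φ
      · exact .inl hs
      · push Not at hs
        obtain ⟨ψ, hψ⟩ := hφ.exists_minStep fun s => (hs s).symm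
        refine .inr ⟨fun k => if k = 0 then φ else ψ, rfl, fun k hk => ?_⟩
        obtain rfl : k = 0 := by omega
        exact hψ
    | succ n ih =>
      intro φ hφ
      rcases ih φ hφ with h | ⟨f, rfl, hf⟩
      · exact .inl (.inl h)
      obtain ⟨-, hψ, s, -, -, hs⟩ := hf 0 (by omega)
      rcases ih _ hψ with h | ⟨f', hf0, hf'⟩
      · refine .inl (.inr (Set.mem_iUnion.2 ⟨s, _, h, ?_⟩))
        rw [hs, ← dualAct_mul, cs.simple_mul_simple_self, dualAct_one]
      · refine .inr ⟨fun k => if k = 0 then f 0 else f' (k - 1), rfl, fun k hk => ?_⟩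
        rcases Nat.eq_zero_or_pos k with rfl | hk0
        · simpa [hf0] using hf 0 (by omega)
        · have := hf' (k - 1) (by omega)
          rw [Nat.sub_add_cancel hk0] at this
          simpa [hk0.ne'] using this
  -- A chain longer than the number of truncated Gram vectors would repeat one of them.
  have hT := finite_truncatedGram cs
  refine (hlv hT.toFinset.card).subset fun φ hφ => ?_
  refine (hchain hT.toFinset.card φ hφ).resolve_right ?_
  rintro ⟨f, -, hf⟩
  obtain ⟨i, hi, j, hj, hij, he⟩ := Finset.exists_ne_map_eq_of_card_lt_of_maps_to
    (s := Finset.range (hT.toFinset.card + 1)) (t := hT.toFinset)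
    (f := fun k => truncatedGram M (f k)) (by simp)
    (fun k hk => by
      simp only [Set.Finite.coe_toFinset]
      exact ⟨_, (hf k (by simpa using hk)).1, rfl⟩)
  rw [Finset.mem_range] at hi hj
  rcases hij.lt_or_gt with h | h
  · exact truncatedGram_ne_of_chain h (fun k hk => hf k (by omega)) he
  · exact truncatedGram_ne_of_chain h (fun k hk => hf k (by omega)) he.symm

end MinimalRoots

/-! ### Hyperplanes and half-spaces in terms of roots -/

section Hyperplanes

variable {B W : Type*} [Fintype B] [DecidableEq B] [Group W] {M : CoxeterMatrix B}
  {cs : CoxeterSystem M W}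

/-- The hyperplane of the Tits cone where a functional vanishes. -/
def hyperOf (cs : CoxeterSystem M W) (φ : Dual ℝ (B → ℝ)) : Set (B → ℝ) :=
  {v ∈ titsCone cs | φ v = 0}

theorem image_fundHyperplane (w : W) (s : B) :
    geomRep cs w '' fundHyperplane cs s = hyperOf cs (dualAct cs w (simpleRoot s)) := by
  ext v
  constructor
  · rintro ⟨x, ⟨hx, hxs⟩, rfl⟩
    exact ⟨geomRep_mem_titsCone w hx, by rwa [dualAct_geomRep]⟩
  · rintro ⟨hv, h⟩
    exact ⟨geomRep cs w⁻¹ v, ⟨geomRep_mem_titsCone _ hv, h⟩, geomRep_apply_inv_self ..⟩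

theorem fundHyperplane_eq (s : B) : fundHyperplane cs s = hyperOf cs (simpleRoot s) := rfl

theorem hyperOf_neg (φ : Dual ℝ (B → ℝ)) : hyperOf cs (-φ) = hyperOf cs φ := by
  simp [hyperOf]

theorem mem_hyperplanes_iff {H : Set (B → ℝ)} :
    H ∈ hyperplanes cs ↔ ∃ φ, IsPosRoot cs φ ∧ H = hyperOf cs φ := by
  constructor
  · rintro ⟨w, s, rfl⟩
    rw [image_fundHyperplane]
    rcases ((isRoot_simpleRoot s).dualAct (cs := cs) w).pos_or_neg with h | h
    · exact ⟨_, h, rfl⟩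
    · exact ⟨_, h, (hyperOf_neg _).symm⟩
  · rintro ⟨_, ⟨⟨w, s, rfl⟩, -⟩, rfl⟩
    exact ⟨w, s, (image_fundHyperplane w s).symm⟩

/-- The hyperplane of a root spans a linear hyperplane, hence it determines the root up to a
scalar. -/
theorem IsRoot.exists_smul_of_hyperOf_eq {φ f : Dual ℝ (B → ℝ)} (hφ : IsRoot cs φ)
    (h : hyperOf cs φ = hyperOf cs f) : ∃ c : ℝ, c ≠ 0 ∧ f = c • φ := by
  obtain ⟨w, s, rfl⟩ := hφ
  have hf : f = rootCoeff (GreedyCoxeter.dualAct cs w⁻¹ f) s •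
      GreedyCoxeter.dualAct cs w (simpleRoot s) := by
    rw [← map_smul, ← dualAct_self_inv cs w f]
    congr 1
    rw [dualAct_self_inv]
    refine dual_ext_rootCoeff fun t => ?_
    rw [rootCoeff_smul, rootCoeff_simpleRoot]
    split_ifs with hst
    · rw [hst, mul_one]
    · have hmem : geomRep cs w (Pi.single t 1) ∈
          hyperOf cs (GreedyCoxeter.dualAct cs w (simpleRoot s)) := by
        refine ⟨geomRep_mem_titsCone w (fundChamber_subset_titsCone fun u => ?_), ?_⟩
        · rw [Pi.single_apply]; split_ifs <;> norm_num
        · rw [dualAct_geomRep, simpleRoot_apply, Pi.single_eq_of_ne hst]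
      rw [h] at hmem
      rw [mul_zero, rootCoeff, dualAct_apply, inv_inv]
      exact hmem.2
  refine ⟨_, fun h0 => ?_, hf⟩
  rw [h0, zero_smul] at hf
  have hmem : geomRep cs w (fun _ => 1) ∈ hyperOf cs f :=
    ⟨geomRep_mem_titsCone w (one_mem_titsCone cs), by rw [hf]; rfl⟩
  rw [← h] at hmem
  have := hmem.2
  rw [dualAct_geomRep] at this
  exact one_ne_zero this

theorem halfOf_smul {c : ℝ} (hc : 0 < c) (φ : Dual ℝ (B → ℝ)) :
    halfOf cs (c • φ) = halfOf cs φ := by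
  ext v
  simp [halfOf, hc]

theorem IsRoot.isHalfspace_iff {φ : Dual ℝ (B → ℝ)} (hφ : IsRoot cs φ) {K : Set (B → ℝ)} :
    IsHalfspace cs (hyperOf cs φ) K ↔ K = halfOf cs φ ∨ K = halfOf cs (-φ) := by
  constructor
  · rintro ⟨f, hf, rfl⟩
    obtain ⟨c, hc, rfl⟩ := hφ.exists_smul_of_hyperOf_eq hf
    change halfOf cs _ = _ ∨ halfOf cs _ = _
    rcases lt_or_gt_of_ne hc with h | h
    · right
      rw [← halfOf_smul (neg_pos.2 h) (-φ), smul_neg, neg_smul, neg_neg]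
    · exact .inl (halfOf_smul h φ)
  · rintro (rfl | rfl)
    · exact ⟨φ, rfl, rfl⟩
    · exact ⟨-φ, (hyperOf_neg φ).symm, rfl⟩

theorem IsPosRoot.not_fundChamber_subset_halfOf_neg {φ : Dual ℝ (B → ℝ)} (h : IsPosRoot cs φ) :
    ¬ fundChamber B ⊆ halfOf cs (-φ) := by
  intro hsub
  have h1 := (hsub (fun _ => zero_le_one : (fun _ => 1 : B → ℝ) ∈ fundChamber B)).2
  have h2 := h.apply_pos (v := fun _ => 1) (by simp)
  rw [LinearMap.neg_apply] at h1
  linarith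

theorem IsPosRoot.posHalf_hyperOf {φ : Dual ℝ (B → ℝ)} (h : IsPosRoot cs φ) :
    posHalf cs (hyperOf cs φ) = halfOf cs φ := by
  ext v
  constructor
  · rintro ⟨K, hK, hC, hv⟩
    rcases h.1.isHalfspace_iff.1 hK with rfl | rfl
    · exact hv
    · exact absurd hC h.not_fundChamber_subset_halfOf_neg
  · exact fun hv => ⟨_, h.1.isHalfspace_iff.2 (.inl rfl), h.fundChamber_subset_halfOf, hv⟩

theorem IsPosRoot.negHalf_hyperOf {φ : Dual ℝ (B → ℝ)} (h : IsPosRoot cs φ) :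
    negHalf cs (hyperOf cs φ) = halfOf cs (-φ) := by
  ext v
  constructor
  · rintro ⟨K, hK, hC, hv⟩
    rcases h.1.isHalfspace_iff.1 hK with rfl | rfl
    · exact absurd h.fundChamber_subset_halfOf hC
    · exact hv
  · exact fun hv => ⟨_, h.1.isHalfspace_iff.2 (.inr rfl), h.not_fundChamber_subset_halfOf_neg, hv⟩

theorem mem_minHyperplanes_iff {H : Set (B → ℝ)} :
    H ∈ minHyperplanes cs ↔ ∃ φ, IsMinRoot cs φ ∧ H = hyperOf cs φ := by
  constructor
  · rintro ⟨hH, hmin⟩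
    obtain ⟨φ, hφ, rfl⟩ := mem_hyperplanes_iff.1 hH
    refine ⟨φ, ⟨hφ, fun ψ hψ hsub => ?_⟩, rfl⟩
    have := hmin (mem_hyperplanes_iff.2 ⟨ψ, hψ, rfl⟩)
    rw [hφ.posHalf_hyperOf, hψ.posHalf_hyperOf] at this
    exact halfOf_injOn hψ.1 hφ.1 (hsub.antisymm (this hsub))
  · rintro ⟨φ, hφ, rfl⟩
    refine ⟨mem_hyperplanes_iff.2 ⟨φ, hφ.1, rfl⟩, fun H' hH' => ?_⟩
    obtain ⟨ψ, hψ, rfl⟩ := mem_hyperplanes_iff.1 hH'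
    rw [hφ.1.posHalf_hyperOf, hψ.posHalf_hyperOf]
    intro hsub
    rw [hφ.2 ψ hψ hsub]

theorem mem_antiCone_iff {σ : Set B} {v : B → ℝ} :
    v ∈ antiCone cs σ ↔ v ∈ titsCone cs ∧ ∀ s ∈ σ, v s ≤ 0 := by
  refine and_congr_right fun hv => forall₂_congr fun s _ => ?_
  rw [fundHyperplane_eq, (isPosRoot_simpleRoot s).negHalf_hyperOf]
  simp [halfOf, hv]

end Hyperplanes

/-! ### Regions -/

section Regions

variable {B W : Type*} [Fintype B] [DecidableEq B] [Group W] {M : CoxeterMatrix B}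
  {cs : CoxeterSystem M W}

/-- A point in the interior of the chamber `wC`. -/
noncomputable def chamberPt (cs : CoxeterSystem M W) (w : W) : B → ℝ := geomRep cs w fun _ => 1

theorem chamberPt_mem_titsCone (w : W) : chamberPt cs w ∈ titsCone cs :=
  geomRep_mem_titsCone w (one_mem_titsCone cs)

theorem geomRep_chamberPt (w u : W) : geomRep cs w (chamberPt cs u) = chamberPt cs (w * u) := by
  rw [chamberPt, chamberPt, geomRep_mul_apply]

theorem apply_chamberPt (w : W) (φ : Dual ℝ (B → ℝ)) :
    φ (chamberPt cs w) = dualAct cs w⁻¹ φ fun _ => 1 := by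
  rw [dualAct_apply, inv_inv, chamberPt]

theorem IsRoot.apply_chamberPt_ne_zero {φ : Dual ℝ (B → ℝ)} (h : IsRoot cs φ) (w : W) :
    φ (chamberPt cs w) ≠ 0 := by
  rw [apply_chamberPt]
  rcases (h.dualAct w⁻¹).pos_or_neg with h' | h'
  · exact (h'.apply_pos (by simp)).ne'
  · have := h'.apply_pos (v := fun _ => 1) (by simp)
    rw [LinearMap.neg_apply] at this
    linarith

theorem mem_desc_iff {w : W} {s : B} : s ∈ desc cs w ↔ chamberPt cs w s < 0 := by
  have h0 := (isRoot_simpleRoot (cs := cs) s).apply_chamberPt_ne_zero w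
  have h1 : chamberPt cs w s = simpleRoot s (chamberPt cs w) := rfl
  rw [desc, Set.mem_ofPred_eq, ← cs.isRightDescent_inv_iff, ← not_iff_not,
    ← isPosRoot_dualAct_iff, h1, not_lt]
  constructor
  · intro h
    rw [apply_chamberPt]
    exact (h.apply_pos (by simp)).le
  · intro h
    rw [apply_chamberPt] at h
    exact ((isRoot_simpleRoot s).dualAct w⁻¹).isPosRoot_of_nonneg (by simp) h

theorem chamberPt_pos_of_notMem_desc {w : W} {s : B} (h : s ∉ desc cs w) :
    0 < chamberPt cs w s := by
  rw [mem_desc_iff, not_lt] at h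
  exact h.lt_of_ne ((isRoot_simpleRoot s).apply_chamberPt_ne_zero w).symm

theorem mul_nonneg_iff_nonpos_of_neg {a b : ℝ} (h : a < 0) : 0 ≤ a * b ↔ b ≤ 0 := by
  rw [← neg_mul_neg, mul_nonneg_iff_of_pos_left (neg_pos.2 h), neg_nonneg]

/-- The points of the Tits cone that no minimal hyperplane separates from `v`. -/
def regionAt (cs : CoxeterSystem M W) (v : B → ℝ) : Set (B → ℝ) :=
  {x ∈ titsCone cs | ∀ φ, IsMinRoot cs φ → 0 ≤ φ v * φ x}

theorem regionAt_congr {v v' : B → ℝ} (h : ∀ φ, IsMinRoot cs φ → 0 < φ v * φ v') :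
    regionAt cs v = regionAt cs v' := by
  ext x
  refine and_congr_right fun _ => forall₂_congr fun φ hφ => ?_
  have h1 := h φ hφ
  rcases pos_and_pos_or_neg_and_neg_of_mul_pos h1 with ⟨h2, h3⟩ | ⟨h2, h3⟩
  · rw [mul_nonneg_iff_of_pos_left h2, mul_nonneg_iff_of_pos_left h3]
  · rw [mul_nonneg_iff_nonpos_of_neg h2, mul_nonneg_iff_nonpos_of_neg h3]

theorem mem_regions_iff {R : Set (B → ℝ)} :
    R ∈ regions cs ↔ ∃ v ∈ titsCone cs, (∀ φ, IsMinRoot cs φ → φ v ≠ 0) ∧ R = regionAt cs v := by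
  refine exists_congr fun v => and_congr_right fun hv => ?_
  have h1 : (∀ H ∈ minHyperplanes cs, v ∉ H) ↔ ∀ φ, IsMinRoot cs φ → φ v ≠ 0 := by
    constructor
    · exact fun h φ hφ h0 => h _ (mem_minHyperplanes_iff.2 ⟨φ, hφ, rfl⟩) ⟨hv, h0⟩
    · intro h H hH hvH
      obtain ⟨φ, hφ, rfl⟩ := mem_minHyperplanes_iff.1 hH
      exact h φ hφ hvH.2
  rw [h1]
  refine and_congr_right fun hne => ?_
  suffices h2 : {x ∈ titsCone cs | ∀ H ∈ minHyperplanes cs, ∀ K, IsHalfspace cs H K → v ∈ K →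
      x ∈ K} = regionAt cs v by rw [h2]
  ext x
  refine and_congr_right fun hx => ?_
  constructor
  · intro h φ hφ
    have hH := h _ (mem_minHyperplanes_iff.2 ⟨φ, hφ, rfl⟩)
    rcases le_total 0 (φ v) with h0 | h0
    · have := hH _ (hφ.1.1.isHalfspace_iff.2 (.inl rfl)) ⟨hv, h0⟩
      exact mul_nonneg h0 this.2
    · have := hH _ (hφ.1.1.isHalfspace_iff.2 (.inr rfl)) ⟨hv, by simpa using h0⟩
      exact mul_nonneg_of_nonpos_of_nonpos h0 (by simpa using this.2)
  · intro h H hH K hK hvK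
    obtain ⟨φ, hφ, rfl⟩ := mem_minHyperplanes_iff.1 hH
    have h0 := h φ hφ
    rcases hφ.1.1.isHalfspace_iff.1 hK with rfl | rfl
    · exact ⟨hx, (mul_nonneg_iff_of_pos_left (lt_of_le_of_ne hvK.2 (hne φ hφ).symm)).1 h0⟩
    · have h3 : φ v ≤ 0 := by simpa using hvK.2
      refine ⟨hx, ?_⟩
      rw [LinearMap.neg_apply, neg_nonneg]
      exact (mul_nonneg_iff_nonpos_of_neg (lt_of_le_of_ne h3 (hne φ hφ))).1 h0

theorem regionAt_chamberPt_mem_regions (w : W) : regionAt cs (chamberPt cs w) ∈ regions cs :=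
  mem_regions_iff.2 ⟨_, chamberPt_mem_titsCone w,
    fun _ hφ => hφ.1.1.apply_chamberPt_ne_zero w, rfl⟩

/-- The region that contains the chamber `wC`. -/
noncomputable def regionOf (cs : CoxeterSystem M W) (w : W) : Region cs :=
  ⟨regionAt cs (chamberPt cs w), regionAt_chamberPt_mem_regions w⟩

theorem chamberPt_mem_regionOf (w : W) : chamberPt cs w ∈ (regionOf cs w).1 :=
  ⟨chamberPt_mem_titsCone w, fun _ _ => mul_self_nonneg _⟩

theorem eq_regionOf_of_mem {R : Region cs} {w : W} (h : chamberPt cs w ∈ R.1) :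
    R = regionOf cs w := by
  obtain ⟨v, -, hne, hR⟩ := mem_regions_iff.1 R.2
  refine Subtype.ext (hR.trans (regionAt_congr fun φ hφ => ?_))
  rw [hR] at h
  exact (h.2 φ hφ).lt_of_ne
    (mul_ne_zero (hne φ hφ) (hφ.1.1.apply_chamberPt_ne_zero w)).symm

theorem regionOf_one : (regionOf cs 1).1 = fundChamber B := by
  ext x
  have h1 : chamberPt cs 1 = fun _ => 1 := geomRep_one_apply cs _
  constructor
  · intro hx s
    simpa [h1] using hx.2 _ (isMinRoot_simpleRoot s)
  · intro hx
    refine ⟨fundChamber_subset_titsCone hx, fun φ hφ => ?_⟩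
    rw [h1]
    exact mul_nonneg (hφ.1.apply_pos (by simp)).le (hφ.1.apply_nonneg hx)

/-- There are finitely many regions: a region is determined by the set of minimal roots that are
positive on it. -/
theorem finite_region (cs : CoxeterSystem M W) : Finite (Region cs) := by
  refine Set.Finite.to_subtype (s := regions cs) ?_
  let F : Set (Dual ℝ (B → ℝ)) → Set (B → ℝ) := fun T =>
    {x ∈ titsCone cs | ∀ φ, IsMinRoot cs φ → (φ ∈ T → 0 ≤ φ x) ∧ (φ ∉ T → φ x ≤ 0)}
  refine ((finite_isMinRoot cs).finite_subsets.image F).subset ?_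
  intro R hR
  obtain ⟨v, hv, hne, rfl⟩ := mem_regions_iff.1 hR
  refine ⟨{φ | IsMinRoot cs φ ∧ 0 < φ v}, fun φ h => h.1, ?_⟩
  ext x
  refine and_congr_right fun _ => forall₂_congr fun φ hφ => ?_
  rcases lt_or_gt_of_ne (hne φ hφ) with h | h
  · simp [hφ, h.le, mul_nonneg_iff_nonpos_of_neg h]
  · simp [hφ, h, mul_nonneg_iff_of_pos_left h]

end Regions

/-! ### Finite parabolic subgroups and their longest elements -/

section Parabolic

variable {B W : Type*} [Fintype B] [DecidableEq B] [Group W] {M : CoxeterMatrix B}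
  {cs : CoxeterSystem M W}

/-- An element of `W_σ` changes a functional only by a combination of the simple roots in `σ`. -/
theorem rootCoeff_dualAct_of_mem_parabolic {σ : Set B} {w : W} (hw : w ∈ parabolic cs σ)
    (φ : Dual ℝ (B → ℝ)) {t : B} (ht : t ∉ σ) :
    rootCoeff (dualAct cs w φ) t = rootCoeff φ t := by
  induction hw using Subgroup.closure_induction generalizing φ with
  | mem x hx =>
    obtain ⟨s, hs, rfl⟩ := hx
    have hst : s ≠ t := fun h => ht (h ▸ hs)
    simp [dualAct_simple, rootCoeff_simpleRoot, hst]
  | one => rw [dualAct_one]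
  | mul x y _ _ hx hy => rw [dualAct_mul, hx, hy]
  | inv x _ hx => rw [← hx, dualAct_self_inv]

theorem inversions_subset_of_mem_parabolic {σ : Set B} {w : W} (hw : w ∈ parabolic cs σ) :
    inversions cs w ⊆ posRootsIn cs σ := by
  rintro φ ⟨h1, h2⟩
  refine ⟨h1, fun t ht => le_antisymm ?_ (h1.2 t)⟩
  have := h2.2 t
  rw [rootCoeff_neg, rootCoeff_dualAct_of_mem_parabolic hw φ ht] at this
  linarith

theorem isSpherical_of_finite_posRootsIn {σ : Set B} (h : (posRootsIn cs σ).Finite) :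
    IsSpherical cs σ := by
  refine Set.Finite.of_finite_image (f := inversions cs) (h.finite_subsets.subset ?_)
    inversions_injective.injOn
  rintro _ ⟨w, hw, rfl⟩
  exact inversions_subset_of_mem_parabolic hw

theorem apply_nonneg_of_mem_posRootsIn {σ : Set B} {φ : Dual ℝ (B → ℝ)}
    (h : φ ∈ posRootsIn cs σ) {v : B → ℝ} (hv : ∀ s ∈ σ, 0 ≤ v s) : 0 ≤ φ v := by
  rw [apply_eq_sum_rootCoeff]
  refine Finset.sum_nonneg fun t _ => ?_
  by_cases ht : t ∈ σ
  · exact mul_nonneg (h.1.2 t) (hv t ht)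
  · rw [h.2 t ht, zero_mul]

theorem apply_nonpos_of_mem_posRootsIn {σ : Set B} {φ : Dual ℝ (B → ℝ)}
    (h : φ ∈ posRootsIn cs σ) {v : B → ℝ} (hv : ∀ s ∈ σ, v s ≤ 0) : φ v ≤ 0 := by
  have := apply_nonneg_of_mem_posRootsIn h (v := -v) (by simpa using hv)
  rwa [map_neg, neg_nonneg] at this

/-- The left descent set of an element generates a finite subgroup. -/
theorem isSpherical_desc (w : W) : IsSpherical cs (desc cs w) := by
  refine isSpherical_of_finite_posRootsIn ((finite_inversions (cs := cs) w⁻¹).subset ?_)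
  intro φ h
  refine ⟨h.1, (h.1.1.neg.dualAct w⁻¹ |> fun h' => ?_)⟩
  rw [← map_neg]
  refine h'.isPosRoot_of_nonneg (v := fun _ => 1) (by simp) ?_
  rw [← apply_chamberPt, LinearMap.neg_apply, neg_nonneg]
  exact apply_nonpos_of_mem_posRootsIn h fun s hs => (mem_desc_iff.1 hs).le

theorem longest_mem (σ : Letter cs) : longest cs σ ∈ parabolic cs σ.1 :=
  (exists_longest cs σ).choose_spec.1

theorem isRightDescent_longest (σ : Letter cs) {s : B} (hs : s ∈ σ.1) :
    cs.IsRightDescent (longest cs σ) s := by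
  have h1 := (exists_longest cs σ).choose_spec.2 (longest cs σ * cs.simple s)
    (mul_mem (longest_mem σ) (Subgroup.subset_closure ⟨s, hs, rfl⟩))
  exact lt_of_le_of_ne h1 (cs.length_mul_simple_ne _ _)

/-- If `σ ⊆ Desc(w_σ u)`, then `u C` lies on the positive side of the hyperplanes `H_s` with
`s ∈ σ`. -/
theorem chamberPt_pos_of_subset_desc {σ : Letter cs} {u : W}
    (h : σ.1 ⊆ desc cs (longest cs σ * u)) {s : B} (hs : s ∈ σ.1) : 0 < chamberPt cs u s := by
  have hneg := isPosRoot_neg_dualAct_of_isRightDescent (isRightDescent_longest σ hs)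
  have hmem : -dualAct cs (longest cs σ) (simpleRoot s) ∈ posRootsIn cs σ.1 := by
    refine ⟨hneg, fun t ht => ?_⟩
    rw [rootCoeff_neg, rootCoeff_dualAct_of_mem_parabolic (longest_mem σ) _ ht,
      rootCoeff_simpleRoot, if_neg (by rintro rfl; exact ht hs), neg_zero]
  have h1 := apply_nonpos_of_mem_posRootsIn hmem (v := chamberPt cs (longest cs σ * u))
    fun t ht => (mem_desc_iff.1 (h ht)).le
  rw [LinearMap.neg_apply, ← geomRep_chamberPt, dualAct_geomRep, simpleRoot_apply,
    neg_nonpos] at h1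
  exact h1.lt_of_ne ((isRoot_simpleRoot s).apply_chamberPt_ne_zero u).symm

end Parabolic

/-! ### Transitions between regions -/

section Transitions

variable {B W : Type*} [Fintype B] [DecidableEq B] [Group W] {M : CoxeterMatrix B}
  {cs : CoxeterSystem M W}

/-- If a region lies on the positive side of `H_s` for all `s ∈ σ`, then no minimal hyperplane cuts
its translate by `w_σ`. Let `γ` be the image under `w_σ⁻¹` of a minimal root. If `γ` is negative, or
if `γ` dominates a positive root inverted by `w_σ`, then `γ` has constant sign on the region because
the positive roots inverted by `w_σ` are supported in `σ`. Otherwise `γ` is minimal. -/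
theorem image_regionOf_subset {σ : Letter cs} {u : W} (h : ∀ s ∈ σ.1, 0 < chamberPt cs u s) :
    geomRep cs (longest cs σ) '' (regionOf cs u).1 ⊆ (regionOf cs (longest cs σ * u)).1 := by
  rintro _ ⟨x, hx, rfl⟩
  refine ⟨geomRep_mem_titsCone _ hx.1, fun β hβ => ?_⟩
  have hσ : ∀ s ∈ σ.1, 0 ≤ x s := fun s hs =>
    (mul_nonneg_iff_of_pos_left (h s hs)).1 (hx.2 _ (isMinRoot_simpleRoot s))
  have hu : ∀ s ∈ σ.1, 0 ≤ chamberPt cs u s := fun s hs => (h s hs).le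
  obtain ⟨γ, rfl⟩ : ∃ γ, β = dualAct cs (longest cs σ) γ :=
    ⟨dualAct cs (longest cs σ)⁻¹ β, by rw [dualAct_self_inv]⟩
  rw [← geomRep_chamberPt, dualAct_geomRep, dualAct_geomRep]
  have hγ : IsRoot cs γ := by
    have := hβ.1.1.dualAct (longest cs σ)⁻¹
    rwa [dualAct_inv_self] at this
  rcases hγ.pos_or_neg with hpos | hneg
  · by_cases hmin : IsMinRoot cs γ
    · exact hx.2 γ hmin
    · obtain ⟨δ, hδ, hsub, hne⟩ : ∃ δ, IsPosRoot cs δ ∧ halfOf cs δ ⊆ halfOf cs γ ∧ δ ≠ γ := by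
        by_contra! hcon
        exact hmin ⟨hpos, hcon⟩
      have hδσ : δ ∈ posRootsIn cs σ.1 := by
        refine inversions_subset_of_mem_parabolic (longest_mem σ) ⟨hδ, ?_⟩
        refine (hδ.1.dualAct (longest cs σ)).pos_or_neg.resolve_left fun h' => hne ?_
        have := hβ.2 _ h' (halfOf_dualAct_subset _ hsub)
        rw [← dualAct_inv_self cs (longest cs σ) δ, this, dualAct_inv_self]
      exact mul_nonneg
        (hsub ⟨chamberPt_mem_titsCone u, apply_nonneg_of_mem_posRootsIn hδσ hu⟩).2
        (hsub ⟨hx.1, apply_nonneg_of_mem_posRootsIn hδσ hσ⟩).2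
  · have hmem : -γ ∈ posRootsIn cs σ.1 :=
      inversions_subset_of_mem_parabolic (longest_mem σ) ⟨hneg, by
        rw [map_neg, neg_neg]; exact hβ.1⟩
    have h1 := apply_nonneg_of_mem_posRootsIn hmem hu
    have h2 := apply_nonneg_of_mem_posRootsIn hmem hσ
    rw [LinearMap.neg_apply, neg_nonneg] at h1 h2
    exact mul_nonneg_of_nonpos_of_nonpos h1 h2

/-- The cone `C_σ` is the union of the regions with left descent set `σ`. -/
theorem regionOf_subset_descCone_iff {σ : Letter cs} {u : W} :
    (regionOf cs u).1 ⊆ descCone cs σ ↔ σ.1 = desc cs u := by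
  constructor
  · intro h
    obtain ⟨-, hcl⟩ := h (chamberPt_mem_regionOf u)
    have hsub : σ.1 ⊆ desc cs u := by
      intro s hs
      have hclosed : IsClosed {v : B → ℝ | v s ≤ 0} :=
        isClosed_le (continuous_apply s) continuous_const
      have h1 : chamberPt cs u s ≤ 0 := closure_minimal
        (fun v hv => (mem_antiCone_iff.1 hv.1).2 s hs) hclosed hcl
      by_contra hd
      exact absurd (chamberPt_pos_of_notMem_desc hd) (not_lt.2 h1)
    by_contra hne
    have hss : σ.1 ⊂ desc cs u := hsub.ssubset_of_ne hne
    have hopen : IsOpen {v : B → ℝ | ∀ s ∈ desc cs u, v s < 0} := by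
      have : {v : B → ℝ | ∀ s ∈ desc cs u, v s < 0} = ⋂ s ∈ desc cs u, {v : B → ℝ | v s < 0} := by
        ext; simp
      rw [this]
      exact (Set.toFinite _).isOpen_biInter fun s _ =>
        isOpen_lt (continuous_apply s) continuous_const
    obtain ⟨y, hy, hyσ, hyτ⟩ := mem_closure_iff.1 hcl _ hopen fun s hs => mem_desc_iff.1 hs
    let τ : Letter cs := ⟨desc cs u, σ.2.1.mono hsub, isSpherical_desc u⟩
    exact hyτ (Set.mem_iUnion.2 ⟨⟨τ, hss⟩,
      mem_antiCone_iff.2 ⟨(mem_antiCone_iff.1 hyσ).1, fun s hs => (hy s hs).le⟩⟩)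
  · intro hσ x hx
    refine ⟨hx.1, ?_⟩
    -- The points `x + ε p`, with `p` in the interior of `u C`, have descent set exactly `σ`.
    have hlim : Filter.Tendsto (fun ε : ℝ => x + ε • chamberPt cs u)
        (nhdsWithin 0 (Set.Ioi 0)) (nhds x) := by
      have : Continuous fun ε : ℝ => x + ε • chamberPt cs u := by fun_prop
      have h0 := this.tendsto 0
      simp only [zero_smul, add_zero] at h0
      exact h0.mono_left nhdsWithin_le_nhds
    refine mem_closure_of_tendsto hlim ?_
    filter_upwards [self_mem_nhdsWithin] with ε hε
    rw [Set.mem_Ioi] at hε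
    refine ⟨mem_antiCone_iff.2 ⟨titsCone_add hx.1 (titsCone_smul hε (chamberPt_mem_titsCone u)),
      fun s hs => ?_⟩, fun hmem => ?_⟩
    · rw [hσ] at hs
      have h1 := mem_desc_iff.1 hs
      have h2 : x s ≤ 0 := (mul_nonneg_iff_nonpos_of_neg h1).1 (hx.2 _ (isMinRoot_simpleRoot s))
      simp only [Pi.add_apply, Pi.smul_apply, smul_eq_mul]
      nlinarith
    · obtain ⟨⟨τ, hτ⟩, hmem⟩ := Set.mem_iUnion.1 hmem
      obtain ⟨t, ht, htσ⟩ := Set.exists_of_ssubset hτ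
      rw [hσ] at htσ
      have h1 := chamberPt_pos_of_notMem_desc htσ
      have h2 : 0 ≤ x t := (mul_nonneg_iff_of_pos_left h1).1 (hx.2 _ (isMinRoot_simpleRoot t))
      have h3 := (mem_antiCone_iff.1 hmem).2 t ht
      simp only [Pi.add_apply, Pi.smul_apply, smul_eq_mul] at h3
      nlinarith [mul_pos hε h1]

/-- The transitions out of the region that contains `u C`. -/
theorem transition_iff {σ : Letter cs} {u : W} {R' : Region cs} :
    (geomRep cs (longest cs σ) '' (regionOf cs u).1 ⊆ R'.1 ∧ R'.1 ⊆ descCone cs σ) ↔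
      R' = regionOf cs (longest cs σ * u) ∧ σ.1 = desc cs (longest cs σ * u) := by
  constructor
  · rintro ⟨h1, h2⟩
    obtain rfl := eq_regionOf_of_mem (R := R') (w := longest cs σ * u) (by
      rw [← geomRep_chamberPt]
      exact h1 ⟨_, chamberPt_mem_regionOf u, rfl⟩)
    exact ⟨rfl, regionOf_subset_descCone_iff.1 h2⟩
  · rintro ⟨rfl, h⟩
    exact ⟨image_regionOf_subset fun s hs => chamberPt_pos_of_subset_desc h.subset hs,
      regionOf_subset_descCone_iff.2 h⟩

end Transitions

/-! ### Inverses of `1 - x` in filtered rings -/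

section Filtered

/-- In a ring with a separated filtration, a limit `y` of the partial sums of the geometric series
of `x ∈ F 1` is a two-sided inverse of `1 - x`. -/
theorem one_sub_mul_eq_one_of_filtration {R : Type*} [Ring R] (F : ℕ → AddSubgroup R)
    (hmul : ∀ m n a b, a ∈ F m → b ∈ F n → a * b ∈ F (m + n)) (hF0 : ∀ a, a ∈ F 0)
    (hsep : ∀ a, (∀ n, a ∈ F n) → a = 0) {x y : R} (hx : x ∈ F 1)
    (hy : ∀ n, y - ∑ i ∈ Finset.range n, x ^ i ∈ F n) :
    (1 - x) * y = 1 ∧ y * (1 - x) = 1 := by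
  have hpow : ∀ n, x ^ n ∈ F n := fun n => by
    induction n with
    | zero => exact hF0 _
    | succ n ih => rw [pow_succ]; exact hmul _ _ _ _ ih hx
  constructor
  · rw [← sub_eq_zero]
    refine hsep _ fun n => ?_
    have h : (1 - x) * y - 1 = (1 - x) * (y - ∑ i ∈ Finset.range n, x ^ i) - x ^ n := by
      rw [mul_sub, mul_neg_geom_sum]; abel
    rw [h]
    have h1 := hmul 0 n _ _ (hF0 (1 - x)) (hy n)
    rw [zero_add] at h1
    exact sub_mem h1 (hpow n)
  · rw [← sub_eq_zero]
    refine hsep _ fun n => ?_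
    have h : y * (1 - x) - 1 = (y - ∑ i ∈ Finset.range n, x ^ i) * (1 - x) - x ^ n := by
      rw [sub_mul, geom_sum_mul_neg]; abel
    rw [h]
    exact sub_mem (hmul n 0 _ _ (hy n) (hF0 (1 - x))) (hpow n)

end Filtered

namespace Series

variable {A : Type*}

@[simp] theorem coeff_sub (f g : Series A) (α : List A) :
    (f - g).coeff α = f.coeff α - g.coeff α := rfl

@[simp] theorem coeff_sum {ι : Type*} (s : Finset ι) (f : ι → Series A) (α : List A) :
    (∑ i ∈ s, f i).coeff α = ∑ i ∈ s, (f i).coeff α := by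
  classical
  induction s using Finset.induction_on with
  | empty => simp
  | insert i s hi ih => rw [Finset.sum_insert hi, Finset.sum_insert hi, coeff_add, ih]

/-- The series all of whose words have length at least `n`. -/
def orderGE (A : Type*) (n : ℕ) : AddSubgroup (Series A) where
  carrier := {f | ∀ α : List A, α.length < n → f.coeff α = 0}
  zero_mem' _ _ := rfl
  add_mem' hf hg α hα := by rw [coeff_add, hf α hα, hg α hα, add_zero]
  neg_mem' {f} hf α hα := by
    change -f.coeff α = 0
    rw [hf α hα, neg_zero]

theorem mem_orderGE {n : ℕ} {f : Series A} :
    f ∈ orderGE A n ↔ ∀ α : List A, α.length < n → f.coeff α = 0 := Iff.rfl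

theorem mem_orderGE_one {f : Series A} : f ∈ orderGE A 1 ↔ f.coeff [] = 0 := by
  rw [mem_orderGE]
  refine ⟨fun h => h [] (by simp), fun h α hα => ?_⟩
  rw [List.eq_nil_of_length_eq_zero (by omega : α.length = 0), h]

theorem mul_mem_orderGE {m n : ℕ} {f g : Series A} (hf : f ∈ orderGE A m) (hg : g ∈ orderGE A n) :
    f * g ∈ orderGE A (m + n) := by
  intro α hα
  rw [coeff_mul]
  refine Finset.sum_eq_zero fun i hi => ?_
  rw [Finset.mem_range] at hi
  rcases lt_or_ge i m with h | h
  · rw [hf _ (by rw [List.length_take]; omega), zero_mul]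
  · rw [hg _ (by rw [List.length_drop]; omega), mul_zero]

theorem pow_mem_orderGE {f : Series A} (hf : f.coeff [] = 0) (n : ℕ) : f ^ n ∈ orderGE A n := by
  induction n with
  | zero => exact fun α hα => absurd hα (by omega)
  | succ n ih => rw [pow_succ]; exact mul_mem_orderGE ih (mem_orderGE_one.2 hf)

/-- If the `n`-th summand involves only words of length at least `n`, then the coefficients of the
partial sums stabilize. -/
theorem sum_coeff_eq_of_orderGE {f : ℕ → Series A} (hf : ∀ n, f n ∈ orderGE A n) {α : List A}
    {m n : ℕ} (hm : α.length < m) (hmn : m ≤ n) :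
    ∑ i ∈ Finset.range n, (f i).coeff α = ∑ i ∈ Finset.range m, (f i).coeff α := by
  symm
  refine Finset.sum_subset (Finset.range_mono hmn) fun i _ hi => hf i α ?_
  rw [Finset.mem_range] at hi
  omega

/-- A series without constant term has a quasi-inverse `g`, and `1 + g` inverts `1 - f`. -/
theorem exists_isQuasiInverse {f : Series A} (hf : f.coeff [] = 0) :
    ∃ g, IsQuasiInverse f g ∧ (1 + g) * (1 - f) = 1 := by
  let g : Series A := mk fun α => (∑ n ∈ Finset.Icc 1 α.length, f ^ n).coeff α
  have hshift : ∀ N, ∑ i ∈ Finset.range (N + 1), f ^ i = 1 + ∑ n ∈ Finset.Icc 1 N, f ^ n := by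
    intro N
    rw [Finset.range_eq_Ico, Finset.sum_eq_sum_Ico_succ_bot (by omega), pow_zero]
    rfl
  have hstab : ∀ N (α : List A), α.length ≤ N →
      (∑ n ∈ Finset.Icc 1 N, f ^ n).coeff α = g.coeff α := by
    intro N α hα
    have h := sum_coeff_eq_of_orderGE (pow_mem_orderGE hf) (α := α) (m := α.length + 1)
      (n := N + 1) (by omega) (by omega)
    rw [← coeff_sum, ← coeff_sum, hshift, hshift, coeff_add, coeff_add] at h
    exact add_left_cancel h
  refine ⟨g, ⟨hf, fun α => ?_⟩, ?_⟩
  · filter_upwards [Filter.eventually_ge_atTop α.length] with N hN using hstab N α hN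
  · refine (one_sub_mul_eq_one_of_filtration (orderGE A) (fun _ _ _ _ => mul_mem_orderGE)
      (fun a α hα => absurd hα (by omega)) (fun a ha => ext fun α => ha _ α α.length.lt_succ_self)
      (mem_orderGE_one.2 hf) fun n α hα => ?_).2
    obtain ⟨N, rfl⟩ := Nat.exists_eq_succ_of_ne_zero (by omega : n ≠ 0)
    rw [Nat.succ_eq_add_one, hshift, coeff_sub, coeff_add, coeff_add, hstab N α (by omega),
      sub_self]

/-- If the entries of a matrix `Q` have no constant terms, then `1 - Q` is invertible. -/
theorem isUnit_one_sub_matrix {n : Type*} [Fintype n] [DecidableEq n]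
    {Q : Matrix n n (Series A)} (hQ : ∀ i j, (Q i j).coeff [] = 0) : IsUnit (1 - Q) := by
  let F : ℕ → AddSubgroup (Matrix n n (Series A)) := fun k =>
    { carrier := {X | ∀ i j, X i j ∈ orderGE A k}
      zero_mem' := fun _ _ => zero_mem _
      add_mem' := fun hX hY i j => add_mem (hX i j) (hY i j)
      neg_mem' := fun hX i j => neg_mem (hX i j) }
  have hmul : ∀ k l X Y, X ∈ F k → Y ∈ F l → X * Y ∈ F (k + l) := by
    intro k l X Y hX hY i j
    rw [Matrix.mul_apply]
    exact sum_mem fun m _ => mul_mem_orderGE (hX i m) (hY m j)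
  have hQ1 : Q ∈ F 1 := fun i j => mem_orderGE_one.2 (hQ i j)
  have hpow : ∀ k, Q ^ k ∈ F k := fun k => by
    induction k with
    | zero => exact fun i j α hα => absurd hα (by omega)
    | succ k ih => rw [pow_succ]; exact hmul _ _ _ _ ih hQ1
  let Y : Matrix n n (Series A) := fun i j =>
    mk fun α => ∑ k ∈ Finset.range (α.length + 1), ((Q ^ k) i j).coeff α
  obtain ⟨h1, h2⟩ := one_sub_mul_eq_one_of_filtration F hmul
    (fun X i j α hα => absurd hα (by omega))
    (fun X hX => by
      ext i j α
      exact hX _ i j α α.length.lt_succ_self)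
    hQ1 (y := Y) fun k i j α hα => by
      rw [Matrix.sub_apply, Matrix.sum_apply, coeff_sub, coeff_sum, sub_eq_zero]
      exact (sum_coeff_eq_of_orderGE (fun k => hpow k i j) (by omega) hα).symm
  exact ⟨⟨1 - Q, Y, h1, h2⟩, rfl⟩

/-! ### Rational series and linear systems -/

theorem isRational_zero : IsRational (0 : Series A) :=
  .polynomial (by simp [IsPolynomial])

theorem isRational_one : IsRational (1 : Series A) := by
  refine .polynomial ((Set.finite_singleton []).subset fun α hα => ?_)
  by_contra h
  refine hα ?_
  rw [coeff_one, if_neg (by simpa using h)]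

theorem IsRational.sum {ι : Type*} {s : Finset ι} {f : ι → Series A}
    (h : ∀ i ∈ s, (f i).IsRational) : (∑ i ∈ s, f i).IsRational := by
  classical
  induction s using Finset.induction_on with
  | empty => exact isRational_zero
  | insert i s hi ih =>
    rw [Finset.sum_insert hi]
    exact .add (h i (by simp)) (ih fun j hj => h j (by simp [hj]))

/-- The solutions of a linear system `X = b + Q X` are rational if `b` and `Q` are rational and the
entries of `Q` have no constant terms (elimination of one variable at a time). -/
theorem isRational_of_linear_system_fin {n : ℕ} {Q : Fin n → Fin n → Series A}
    {b X : Fin n → Series A} (hQ : ∀ i j, (Q i j).IsRational) (hQ0 : ∀ i j, (Q i j).coeff [] = 0)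
    (hb : ∀ i, (b i).IsRational) (hX : ∀ i, X i = b i + ∑ j, Q i j * X j) (i : Fin n) :
    (X i).IsRational := by
  induction n with
  | zero => exact i.elim0
  | succ n ih =>
    obtain ⟨g, hg, hinv⟩ := exists_isQuasiInverse (hQ0 0 0)
    have he : (1 + g).IsRational := .add isRational_one (.quasiInverse (hQ 0 0) hg)
    have hX0 : X 0 = (1 + g) * (b 0 + ∑ j : Fin n, Q 0 j.succ * X j.succ) := by
      have h := hX 0
      rw [Fin.sum_univ_succ] at h
      have h' : (1 - Q 0 0) * X 0 = b 0 + ∑ j : Fin n, Q 0 j.succ * X j.succ := by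
        rw [sub_mul, one_mul, sub_eq_iff_eq_add]
        refine h.trans ?_
        abel
      rw [← h', ← mul_assoc, hinv, one_mul]
    have hsucc : ∀ i : Fin n, (X i.succ).IsRational := by
      refine ih (Q := fun i j => Q i.succ j.succ + Q i.succ 0 * ((1 + g) * Q 0 j.succ))
        (b := fun i => b i.succ + Q i.succ 0 * ((1 + g) * b 0)) ?_ ?_ ?_ ?_
      · exact fun i j => .add (hQ _ _) (.mul (hQ _ _) (.mul he (hQ _ _)))
      · intro i j
        rw [coeff_add, coeff_mul_nil, hQ0, hQ0, zero_mul, add_zero]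
      · exact fun i => .add (hb _) (.mul (hQ _ _) (.mul he (hb _)))
      · intro i
        rw [hX i.succ, Fin.sum_univ_succ, hX0]
        simp only [add_mul (_ : Series A) (_ * _), mul_add (Q i.succ 0), mul_add (1 + g),
          Finset.mul_sum, Finset.sum_add_distrib, mul_assoc]
        abel
    refine Fin.cases ?_ hsucc i
    rw [hX0]
    exact .mul he (.add (hb _) (.sum fun j _ => .mul (hQ _ _) (hsucc j)))

theorem isRational_of_linear_system {n : Type*} [Fintype n] {Q : n → n → Series A}
    {b X : n → Series A} (hQ : ∀ i j, (Q i j).IsRational) (hQ0 : ∀ i j, (Q i j).coeff [] = 0)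
    (hb : ∀ i, (b i).IsRational) (hX : ∀ i, X i = b i + ∑ j, Q i j * X j) (i : n) :
    (X i).IsRational := by
  have e := Fintype.equivFin n
  have := isRational_of_linear_system_fin (Q := fun i j => Q (e.symm i) (e.symm j))
    (b := fun i => b (e.symm i)) (X := fun i => X (e.symm i)) (fun _ _ => hQ _ _)
    (fun _ _ => hQ0 _ _) (fun _ => hb _)
    (fun i => by rw [hX, ← e.symm.sum_comp]) (e i)
  simpa using this

/-- Multiplication on the left by a series supported on words of length one. -/
theorem coeff_mul_cons_of_support {f g : Series A}
    (hf : ∀ α : List A, α.length ≠ 1 → f.coeff α = 0) (a : A) (α : List A) :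
    (f * g).coeff (a :: α) = f.coeff [a] * g.coeff α := by
  rw [coeff_mul, Finset.sum_eq_single 1]
  · simp
  · intro i hi hi1
    rw [Finset.mem_range] at hi
    rw [hf _ (by rw [List.length_take]; omega), zero_mul]
  · intro h
    simp at h

end Series

/-! ### The automaton -/

section Automaton

variable {B W : Type*} [Fintype B] [DecidableEq B] [Group W] {M : CoxeterMatrix B}
  {cs : CoxeterSystem M W}

theorem nil_mem_greedy : [] ∈ greedy cs := by
  intro σ β h
  simp at h

theorem cons_mem_greedy_iff {σ : Letter cs} {α : List (Letter cs)} :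
    σ :: α ∈ greedy cs ↔ α ∈ greedy cs ∧ σ.1 = desc cs (longest cs σ * wordElt cs α) := by
  constructor
  · intro h
    exact ⟨fun τ β hβ => h τ β (hβ.trans (List.suffix_cons σ α)), h σ α List.suffix_rfl⟩
  · rintro ⟨h1, h2⟩ τ β hβ
    rcases List.suffix_cons_iff.1 hβ with h | h
    · cases h
      exact h2
    · exact h1 τ β h

instance finite_letter : Finite (Letter cs) :=
  inferInstanceAs (Finite {σ : Set B // σ.Nonempty ∧ IsSpherical cs σ})

theorem transitionMatrix_coeff_of_length_ne_one {R' R : Region cs} {α : List (Letter cs)}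
    (h : α.length ≠ 1) : (transitionMatrix cs R' R).coeff α = 0 := by
  rw [transitionMatrix, Series.coeff_mk, if_neg]
  rintro ⟨σ, rfl, -⟩
  exact h rfl

theorem isRational_transitionMatrix (R' R : Region cs) :
    (transitionMatrix cs R' R).IsRational := by
  refine .polynomial ((Set.finite_range fun σ : Letter cs => [σ]).subset fun α hα => ?_)
  by_contra hcon
  refine hα (transitionMatrix_coeff_of_length_ne_one fun h => hcon ?_)
  obtain ⟨σ, rfl⟩ := List.length_eq_one_iff.1 h
  exact ⟨σ, rfl⟩

open Classical in
theorem transitionMatrix_coeff_singleton {R' : Region cs} {u : W} {σ : Letter cs} :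
    (transitionMatrix cs R' (regionOf cs u)).coeff [σ] =
      if R' = regionOf cs (longest cs σ * u) ∧ σ.1 = desc cs (longest cs σ * u) then 1 else 0 := by
  rw [transitionMatrix, Series.coeff_mk]
  refine if_congr ?_ rfl rfl
  rw [← transition_iff]
  exact ⟨fun ⟨τ, h, h'⟩ => by cases h; exact h', fun h => ⟨σ, rfl, h⟩⟩

open Classical in
/-- The sum of the greedy words `α` such that `R` contains the chamber `π(α) C`. -/
noncomputable def regionSeries (cs : CoxeterSystem M W) (R : Region cs) : Series (Letter cs) :=
  Series.mk fun α => if α ∈ greedy cs ∧ R = regionOf cs (wordElt cs α) then 1 else 0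

/-- Reading the first letter of a greedy word: the linear system `X = b + Q X`, where `b` is
the column vector `colVec`. -/
theorem regionSeries_eq [Fintype (Region cs)] (R' : Region cs) :
    regionSeries cs R' = colVec cs R' + ∑ R, transitionMatrix cs R' R * regionSeries cs R := by
  classical
  ext α
  rw [Series.coeff_add, Series.coeff_sum]
  cases α with
  | nil =>
    have h1 : R' = regionOf cs (wordElt cs []) ↔ R'.1 = fundChamber B := by
      rw [← regionOf_one (cs := cs)]
      exact Subtype.ext_iff
    rw [Finset.sum_eq_zero fun R _ => by
      rw [Series.coeff_mul_nil, transitionMatrix_coeff_of_length_ne_one (by simp), zero_mul]]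
    rw [regionSeries, Series.coeff_mk, colVec, add_zero]
    by_cases h : R'.1 = fundChamber B
    · rw [if_pos ⟨nil_mem_greedy, h1.2 h⟩, if_pos h]
      rfl
    · rw [if_neg fun h' => h (h1.1 h'.2), if_neg h]
      rfl
  | cons σ α =>
    have h0 : (colVec cs R').coeff (σ :: α) = 0 := by
      rw [colVec]
      split_ifs <;> simp [Series.coeff_one]
    rw [h0, zero_add]
    simp only [Series.coeff_mul_cons_of_support
      fun _ => transitionMatrix_coeff_of_length_ne_one]
    rw [Finset.sum_eq_single (regionOf cs (wordElt cs α))]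
    · rw [transitionMatrix_coeff_singleton]
      simp only [regionSeries, Series.coeff_mk, cons_mem_greedy_iff, and_true]
      have hw : wordElt cs (σ :: α) = longest cs σ * wordElt cs α := rfl
      rw [hw, ite_mul, one_mul, zero_mul, ← ite_and]
      exact if_congr (by tauto) rfl rfl
    · intro R _ hR
      simp [regionSeries, hR]
    · simp

theorem charSeries_greedy_eq_sum [Fintype (Region cs)] :
    Series.charSeries (greedy cs) = ∑ R, regionSeries cs R := by
  classical
  ext α
  rw [Series.coeff_sum]
  simp [regionSeries, Series.charSeries, ite_and]

open Classical in
/-- The deterministic automaton of the reversed greedy language: it starts in the fundamental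
chamber, follows the nonzero entries of the transition matrix, and stops in the state `none` when
there is none. -/
noncomputable def reverseAutomaton (cs : CoxeterSystem M W) :
    DFA (Letter cs) (Option (Region cs)) where
  step o σ := o.bind fun R =>
    if h : ∃ R' : Region cs, geomRep cs (longest cs σ) '' R.1 ⊆ R'.1 ∧ R'.1 ⊆ descCone cs σ
    then some h.choose else none
  start := some (regionOf cs 1)
  accept := {o | o ≠ none}

open Classical in
theorem reverseAutomaton_eval (x : List (Letter cs)) :
    (reverseAutomaton cs).eval x =
      if x.reverse ∈ greedy cs then some (regionOf cs (wordElt cs x.reverse)) else none := by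
  induction x using List.reverseRecOn with
  | nil =>
    rw [List.reverse_nil, if_pos nil_mem_greedy]
    rfl
  | append_singleton x σ ih =>
    rw [DFA.eval_append_singleton, ih, List.reverse_append, List.reverse_singleton,
      List.singleton_append, cons_mem_greedy_iff]
    by_cases hx : x.reverse ∈ greedy cs
    · rw [if_pos hx]
      simp only [reverseAutomaton, Option.bind_some, transition_iff]
      by_cases hd : σ.1 = desc cs (longest cs σ * wordElt cs x.reverse)
      · have hex : ∃ R', R' = regionOf cs (longest cs σ * wordElt cs x.reverse) ∧
            σ.1 = desc cs (longest cs σ * wordElt cs x.reverse) := ⟨_, rfl, hd⟩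
        rw [dif_pos hex, if_pos ⟨hx, hd⟩, hex.choose_spec.1]
        rfl
      · rw [dif_neg fun ⟨_, _, h⟩ => hd h, if_neg fun h => hd h.2]
    · rw [if_neg hx, if_neg fun h => hx h.1]
      rfl

theorem isRegular_greedy (cs : CoxeterSystem M W) : (greedy cs).IsRegular := by
  classical
  have := finite_region cs
  have := Fintype.ofFinite (Region cs)
  refine Language.IsRegular.of_reverse (Language.isRegular_iff.2
    ⟨Option (Region cs), inferInstance, reverseAutomaton cs, ?_⟩)
  ext x
  rw [DFA.mem_accepts, reverseAutomaton_eval, Language.mem_reverse]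
  by_cases h : x.reverse ∈ greedy cs
  · simp [h, reverseAutomaton]
  · simp [h, reverseAutomaton]

end Automaton

end GreedyCoxeter

open GreedyCoxeter in
theorem theoremA {B W : Type*} [Finite B] [Group W] {M : CoxeterMatrix B}
    (cs : CoxeterSystem M W) :
    (∃ (_ : Fintype (Region cs))
      (P : (Matrix (Region cs) (Region cs) (Series (Letter cs)))ˣ),
      (P : Matrix (Region cs) (Region cs) (Series (Letter cs))) = 1 - transitionMatrix cs ∧
      Series.charSeries (greedy cs) =
        rowVec cs ⬝ᵥ Matrix.mulVec
          ((P⁻¹ : (Matrix (Region cs) (Region cs) (Series (Letter cs)))ˣ) :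
            Matrix (Region cs) (Region cs) (Series (Letter cs))) (colVec cs)) ∧
    (Series.charSeries (greedy cs)).IsRational ∧
    (greedy cs).IsRegular := by
  classical
  have := Fintype.ofFinite B
  have := finite_region cs
  have := Fintype.ofFinite (Region cs)
  have hnil : ∀ R' R, (transitionMatrix cs R' R).coeff [] = 0 := fun _ _ =>
    transitionMatrix_coeff_of_length_ne_one (by simp)
  refine ⟨⟨inferInstance, ?_⟩, ?_, isRegular_greedy cs⟩
  · obtain ⟨P, hP⟩ := Series.isUnit_one_sub_matrix hnil
    refine ⟨P, hP, ?_⟩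
    have hsolve : P.1.mulVec (regionSeries cs) = colVec cs := by
      rw [hP, Matrix.sub_mulVec, Matrix.one_mulVec, sub_eq_iff_eq_add]
      exact funext regionSeries_eq
    rw [← hsolve, Matrix.mulVec_mulVec, Units.inv_mul, Matrix.one_mulVec,
      charSeries_greedy_eq_sum]
    simp [dotProduct, rowVec]
  · rw [charSeries_greedy_eq_sum]
    refine .sum fun R _ => Series.isRational_of_linear_system isRational_transitionMatrix hnil
      (fun R => ?_) regionSeries_eq R
    rw [colVec]
    split_ifs
    exacts [Series.isRational_one, Series.isRational_zero]
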